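/- Let $q\in\mathbb{C}$ with $0<|q|<1$, and fix a square root $q^{1/2}$ of $q$. For a meromorphic function $f$ in $\mathbb{C}$, write $x=(z+1/z)/2$ with $z\in\mathbb{C}\setminus\{0\}$ and $\breve f(z)=f((z+1/z)/2)$. The Askey–Wilson operator is $$(\mathcal{D}_qf)(x)=\frac{\breve f(q^{1/2}z)-\breve f(q^{-1/2}z)}{(q^{1/2}-q^{-1/2})(z-1/z)/2}\quad(x\neq\pm1),\qquad (\mathcal{D}_qf)(\pm1)=f'\!\left(\pm\tfrac{q^{1/2}+q^{-1/2}}2\right),$$ which does not depend on the choice of $z$, with $\mathcal{D}_q^0f=f$ and $\mathcal{D}_q^{k}f=\mathcal{D}_q(\mathcal{D}_q^{k-1}f)$. Let $\varphi,s:(R_0,\infty)\to(0,\infty)$ be non-decreasing, with $\varphi$ unbounded. Assume that for all sufficiently large $r$ $$\log r\le\varphi(r)\le r,\qquad r<s(r)\le r^2,$$ that $\liminf_{r\to\infty}s(r)/r>1$, and that $\varphi$ is subadditive, i.e. $\varphi(a+b)\le\varphi(a)+\varphi(b)$ for all sufficiently large $a,b$. Put $$\alpha_{\varphi,s}=\liminf_{r\to\infty}\frac{\log\varphi(r)}{\log\varphi(s(r))},\qquad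 \gamma_{\varphi,s}=\liminf_{r\to\infty}\frac{\log\log\frac{s(r)}r}{\log\varphi(r)},\qquad \rho_\varphi(f)=\limsup_{r\to\infty}\frac{\log T(r,f)}{\log\varphi(r)},$$ where $T(r,f)$ is the Nevanlinna characteristic and $\rho_\varphi(f)\in[-\infty,\infty]$, with $\log 0=-\infty$. Let $n\ge1$, and let $a_0,\dots,a_n$ be meromorphic functions in $\mathbb{C}$ with $a_0a_n\not\equiv0$, with $\rho_\varphi(a_j)<\infty$ for $0\le j\le n$, and with $\rho_\varphi(a_0)>\max_{1\le j\le n}\rho_\varphi(a_j)$. Let $f$ be a non-constant meromorphic function in $\mathbb{C}$ satisfying $$\sum_{j=0}^na_j(x)\,\mathcal{D}_q^jf(x)=0$$ as an identity between meromorphic functions. (a) If $\limsup_{r\to\infty}s(r)/r=\infty$ and $s$ is convex and differentiable on $(R_0,\infty)$, then $$\rho_\varphi(f)\ge\alpha_{\varphi,s}^n\,\rho_\varphi(a_0).$$ If, moreover, $a_0,\dots,a_n$ are entire, then $$\rho_\varphi(f)\ge\alpha_{\varphi,s}^n\,\rho_\varphi(a_0)+\alpha_{\varphi,s}^n\,\gamma_{\varphi,s}.$$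 (b) If $\limsup_{r\to\infty}s(r)/r<\infty$, then $\rho_\varphi(f)\ge\alpha_{\varphi,s}^{n-1}\rho_\varphi(a_0)$. -/

import Mathlib

open Filter Set

/-- The function `breve f`, namely `z ↦ f ((z + 1/z) / 2)`. -/
noncomputable def breve (f : ℂ → ℂ) (z : ℂ) : ℂ := f ((z + z⁻¹) / 2)

/-- The point `z = x + √(x² - 1)`, a solution of `x = (z + 1/z) / 2`, with a fixed branch of the
square root.  The other solution is `1/z`. -/
noncomputable def zPoint (x : ℂ) : ℂ := x + (x ^ 2 - 1) ^ (1 / 2 : ℂ)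

/-- The Askey-Wilson operator `D_q`, where `p` is the chosen value of `q^(1/2)`:
`(D_q f)(x) = (f̆(p z) - f̆(p⁻¹ z)) / (ĕ(p z) - ĕ(p⁻¹ z))` for `x = (z + 1/z) / 2 ≠ ±1`, where
`e(x) = x`, and the limiting value `f'(±(p + p⁻¹) / 2)` at `x = ±1`. -/
noncomputable def askeyWilson (p : ℂ) (f : ℂ → ℂ) (x : ℂ) : ℂ :=
  open Classical in
  if x = 1 ∨ x = -1 then deriv f (x * ((p + p⁻¹) / 2))
  else (breve f (p * zPoint x) - breve f (p⁻¹ * zPoint x)) /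
    (breve id (p * zPoint x) - breve id (p⁻¹ * zPoint x))

theorem zPoint_mul (x : ℂ) : zPoint x * (x - (x ^ 2 - 1) ^ (1 / 2 : ℂ)) = 1 := by
  have h : ((x ^ 2 - 1) ^ (1 / 2 : ℂ)) ^ 2 = x ^ 2 - 1 := by
    rw [one_div]
    exact Complex.cpow_nat_inv_pow (x ^ 2 - 1) two_ne_zero
  unfold zPoint
  linear_combination -h

theorem zPoint_ne_zero (x : ℂ) : zPoint x ≠ 0 := fun h => by
  simpa [h] using zPoint_mul x

theorem zPoint_spec (x : ℂ) : (zPoint x + (zPoint x)⁻¹) / 2 = x := by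
  rw [inv_eq_of_mul_eq_one_right (zPoint_mul x), zPoint]
  ring

/-- The operator does not depend on the choice of the solution `z` of `x = (z + 1/z) / 2`. -/
theorem askeyWilson_eq (p : ℂ) (f : ℂ → ℂ) {x z : ℂ} (hz : z ≠ 0) (hx : (z + z⁻¹) / 2 = x)
    (h1 : x ≠ 1) (h2 : x ≠ -1) :
    askeyWilson p f x =
      (breve f (p * z) - breve f (p⁻¹ * z)) / (breve id (p * z) - breve id (p⁻¹ * z)) := by
  have hw := zPoint_ne_zero x
  have hws := zPoint_spec x
  rw [askeyWilson, if_neg (not_or.mpr ⟨h1, h2⟩)]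
  have key : (zPoint x - z) * (zPoint x * z - 1) = 0 := by
    generalize zPoint x = w at hw hws
    rw [← hx] at hws
    field_simp at hws
    linear_combination hws
  rcases mul_eq_zero.mp key with h | h
  · rw [sub_eq_zero.mp h]
  · have e : zPoint x = z⁻¹ := eq_inv_of_mul_eq_one_left (sub_eq_zero.mp h)
    have A : ∀ g : ℂ → ℂ, breve g (p * z⁻¹) = breve g (p⁻¹ * z) := fun g => by
      simp only [breve, mul_inv, inv_inv]
      rw [add_comm]
    have B : ∀ g : ℂ → ℂ, breve g (p⁻¹ * z⁻¹) = breve g (p * z) := fun g => by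
      simp only [breve, mul_inv, inv_inv]
      rw [add_comm]
    rw [e, A, A, B, B, ← neg_sub (breve f _), ← neg_sub (breve id _), neg_div_neg_eq]

/-- The `φ`-order `limsup log T(r, f) / log φ(r)` of a meromorphic function in the plane, as an
extended real, where `T` is the Nevanlinna characteristic and `log 0 = -∞`. -/
noncomputable def phiOrder (φ : ℝ → ℝ) (f : ℂ → ℂ) : EReal :=
  limsup (fun r : ℝ =>
    ENNReal.log (ENNReal.ofReal (ValueDistribution.characteristic f ⊤ r)) /
      ((Real.log (φ r) : ℝ) : EReal)) atTop

/-- `α_{φ,s} = liminf log φ(r) / log φ(s(r))`. -/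
noncomputable def alphaParam (φ s : ℝ → ℝ) : EReal :=
  liminf (fun r : ℝ => ((Real.log (φ r) / Real.log (φ (s r)) : ℝ) : EReal)) atTop

/-- `γ_{φ,s} = liminf log log (s(r) / r) / log φ(r)`. -/
noncomputable def gammaParam (φ s : ℝ → ℝ) : EReal :=
  liminf (fun r : ℝ =>
    ((Real.log (Real.log (s r / r)) / Real.log (φ r) : ℝ) : EReal)) atTop

/-- The standing assumptions on `φ : (R₀, ∞) → (0, ∞)`; values of `φ` outside `(R₀, ∞)` are
irrelevant. -/
structure IsGrowthFunction (R₀ : ℝ) (φ : ℝ → ℝ) : Prop where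
  pos : ∀ r ∈ Ioi R₀, 0 < φ r
  mono : MonotoneOn φ (Ioi R₀)
  unbounded : ¬ BddAbove (φ '' Ioi R₀)
  log_le : ∀ᶠ r in atTop, Real.log r ≤ φ r
  le_self : ∀ᶠ r in atTop, φ r ≤ r

/-- Subadditivity of `φ` for all large arguments. -/
def EventuallySubadditive (φ : ℝ → ℝ) : Prop :=
  ∃ R₁ : ℝ, ∀ a b : ℝ, R₁ ≤ a → R₁ ≤ b → φ (a + b) ≤ φ a + φ b

/-- The standing assumptions on `s : (R₀, ∞) → (0, ∞)`; values of `s` outside `(R₀, ∞)` are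
irrelevant. -/
structure IsScaleFunction (R₀ : ℝ) (s : ℝ → ℝ) : Prop where
  pos : ∀ r ∈ Ioi R₀, 0 < s r
  mono : MonotoneOn s (Ioi R₀)
  lt_self : ∀ᶠ r in atTop, r < s r
  le_sq : ∀ᶠ r in atTop, s r ≤ r ^ 2
  one_lt_liminf : 1 < liminf (fun r : ℝ => ((s r / r : ℝ) : EReal)) atTop

/-- `f` is a non-constant meromorphic function in the plane.  Meromorphic functions are identified
when they agree off a closed discrete set. -/
def IsNonconstantMeromorphic (f : ℂ → ℂ) : Prop :=
  Meromorphic f ∧ ¬ ∃ c : ℂ, f =ᶠ[codiscrete ℂ] fun _ => c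

/-- `f` solves `∑_{j ≤ n} a_j D_q^j f = 0`, as an identity between meromorphic functions, that is,
off a closed discrete set (which takes care of the poles). -/
def SolvesAskeyWilson (p : ℂ) (n : ℕ) (a : ℕ → ℂ → ℂ) (f : ℂ → ℂ) : Prop :=
  (fun x => ∑ j ∈ Finset.range (n + 1), a j x * ((askeyWilson p)^[j] f) x) =ᶠ[codiscrete ℂ] 0

namespace AskeyWilsonGrowth

open Real Metric Function Topology

/-! ### Circle averages -/

/-! Write x = (z + 1/z)/2 with |z| > 1. For large |x|, each iterate of the operator at x is a finite
combination, with bounded analytic weights, of values of f at points (cz + 1/(cz))/2 with c ≠ 0. The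
equation becomes `a 0 * f = -∑ a (k i) * b i * (f ∘ shift (c i))` near infinity with all `k i ≥ 1`
(`exists_shiftRelation`), and it remains to compare characteristics.

Dividing by f bounds the proximity function of `a 0` by those of the other coefficients plus circle
averages of |log|f(shift c x)| - log|f(x)||. Such an average is at most C T(S,f)/log(S/r) for every
S ≥ Λr (`exists_circleAverage_abs_log_shift_le`): on a larger disk log|f| is a harmonic function
plus logarithmic potentials of the zeros and poles; the harmonic part varies slowly by the Poisson
formula, and each potential changes by O(1) in mean. Poles of `a 0` come from poles of the other
coefficients, zeros of f, or poles of f at shifted points, at a cost of C T(Λr,f)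
(`ShiftRelation.exists_logCounting_le`).

With S = Λr this yields T(r,a_0) ≤ ∑ T(r,a_k) + C T(Λr,f). Since φ(Λr) = O(φ(r)) by subadditivity,
ρ(a_0) ≤ ρ(f) (`ShiftRelation.phiOrder_le`). As 0 ≤ α ≤ 1 and ρ(f) ≥ 0, this gives (b) and the first
half of (a), for any power of α. If `a 0` is entire there is no pole term, so S = Λs(r) is allowed;
the denominator log(S/r) then contributes γ, and α(ρ(a_0) + γ) ≤ ρ(f)
(`ShiftRelation.mul_add_le_of_entire`), which is enough because α^n ≤ α. -/

theorem circleAverage_mono_codiscreteWithin {f g : ℂ → ℝ} {c : ℂ} {R : ℝ} (hR : R ≠ 0)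
    (hf : CircleIntegrable f c R) (hg : CircleIntegrable g c R)
    (h : ∀ᶠ x in codiscreteWithin (sphere c |R|), f x ≤ g x) :
    circleAverage f c R ≤ circleAverage g c R := by
  -- Passing to `min f g` changes `f` only off a codiscrete set, and the inequality then holds at
  -- every point of the circle.
  have h' : f =ᶠ[codiscreteWithin (sphere c |R|)] fun x => min (f x) (g x) := by
    filter_upwards [h] with x hx using (min_eq_left hx).symm
  rw [circleAverage_congr_codiscreteWithin h' hR]
  exact circleAverage_mono (hf.congr_codiscreteWithin h') hg fun x _ => min_le_right _ _

theorem circleIntegrable_log_norm_sub (u : ℂ) (R : ℝ) :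
    CircleIntegrable (fun x : ℂ => log ‖x - u‖) 0 R :=
  MeromorphicOn.circleIntegrable_log_norm (f := fun x => x - u) (fun _ _ => by fun_prop)

theorem abs_log_eq_posLog_add_posLog_inv (t : ℝ) : |log t| = log⁺ t + log⁺ t⁻¹ := by
  rw [← half_mul_log_add_log_abs, ← half_mul_log_add_log_abs, log_inv, abs_neg]
  ring

theorem log_le_of_le_exp {t M : ℝ} (h0 : 0 ≤ t) (hM : 0 ≤ M) (h : t ≤ exp M) : log t ≤ M := by
  rcases h0.eq_or_lt with rfl | h0
  · simpa using hM
  · exact (log_le_iff_le_exp h0).2 h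

/-! ### Harmonic functions on a disk -/

/-- The Herglotz kernels differ by 2ζ(w - x)/((ζ - w)(ζ - x)), and both factors of the denominator
have modulus at least R/2. -/
theorem abs_poissonKernel_sub_le {R : ℝ} (hR : 0 < R) {x w ζ : ℂ} (hx : ‖x‖ ≤ R / 2)
    (hw : ‖w‖ ≤ R / 2) (hζ : ‖ζ‖ = R) :
    |poissonKernel 0 w ζ - poissonKernel 0 x ζ| ≤ 8 * ‖w - x‖ / R := by
  have h1 : ∀ y : ℂ, ‖y‖ ≤ R / 2 → R / 2 ≤ ‖ζ - y‖ := fun y hy => by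
    have := norm_sub_norm_le ζ y
    linarith
  have hne : ∀ y : ℂ, ‖y‖ ≤ R / 2 → ζ - y ≠ 0 := fun y hy h => by
    have := h1 y hy
    rw [h, norm_zero] at this
    linarith
  rw [poissonKernel_eq_re_herglotzRieszKernel, poissonKernel_eq_re_herglotzRieszKernel]
  simp only [comp_apply, herglotzRieszKernel_def, sub_zero, ← Complex.sub_re]
  have e : (ζ + w) / (ζ - w) - (ζ + x) / (ζ - x)
      = 2 * ζ * (w - x) / ((ζ - w) * (ζ - x)) := by
    have := hne w hw
    have := hne x hx
    field_simp
    ring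
  refine (Complex.abs_re_le_norm _).trans ?_
  rw [e, norm_div, norm_mul, norm_mul, norm_mul, hζ]
  have h2 := mul_le_mul (h1 w hw) (h1 x hx) (by positivity) (norm_nonneg _)
  calc ‖(2 : ℂ)‖ * R * ‖w - x‖ / (‖ζ - w‖ * ‖ζ - x‖)
      ≤ ‖(2 : ℂ)‖ * R * ‖w - x‖ / (R / 2 * (R / 2)) := by gcongr
    _ = 8 * ‖w - x‖ / R := by
      rw [Complex.norm_ofNat]
      field_simp
      ring

theorem abs_harmonic_sub_le {R : ℝ} (hR : 0 < R) {h : ℂ → ℝ}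
    (hh : InnerProductSpace.HarmonicOnNhd h (closedBall 0 R)) {x w : ℂ} (hx : ‖x‖ ≤ R / 2)
    (hw : ‖w‖ ≤ R / 2) :
    |h w - h x| ≤ 8 * ‖w - x‖ / R * circleAverage (fun ζ => |h ζ|) 0 R := by
  have mem : ∀ y : ℂ, ‖y‖ ≤ R / 2 → y ∈ ball (0 : ℂ) R := fun y hy => by
    rw [mem_ball_zero_iff]
    linarith
  have hc : ContinuousOn h (sphere 0 |R|) := by
    rw [abs_of_pos hR]
    exact hh.continuousOn.mono sphere_subset_closedBall
  have hk : ∀ y : ℂ, ‖y‖ ≤ R / 2 → ContinuousOn (poissonKernel 0 y) (sphere 0 |R|) := by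
    intro y hy
    rw [poissonKernel_eq_re_herglotzRieszKernel]
    exact Complex.continuous_re.comp_continuousOn (continuousOn_herglotzRieszKernel_sphere (mem y hy))
  have hi : ∀ y : ℂ, ‖y‖ ≤ R / 2 → CircleIntegrable (poissonKernel 0 y • h) 0 R := fun y hy =>
    ContinuousOn.circleIntegrable' ((hk y hy).smul hc)
  have e : h w - h x = circleAverage (poissonKernel 0 w • h - poissonKernel 0 x • h) 0 R := by
    rw [circleAverage_sub (hi w hw) (hi x hx), hh.circleAverage_poissonKernel_smul (mem w hw),
      hh.circleAverage_poissonKernel_smul (mem x hx)]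
  rw [e, ← smul_eq_mul, ← circleAverage_fun_smul]
  refine abs_circleAverage_le_circleAverage_abs.trans (circleAverage_mono ?_ ?_ ?_)
  · exact ((hi w hw).sub (hi x hx)).abs
  · exact ContinuousOn.circleIntegrable' (continuousOn_const.fun_smul hc.abs)
  · intro ζ hζ
    rw [abs_of_pos hR, mem_sphere_zero_iff_norm] at hζ
    rw [← sub_smul]
    change |(poissonKernel 0 w ζ - poissonKernel 0 x ζ) * h ζ| ≤ _ * |h ζ|
    rw [abs_mul]
    exact mul_le_mul_of_nonneg_right (abs_poissonKernel_sub_le hR hx hw hζ) (abs_nonneg _)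

/-! ### Averages of logarithmic potentials -/

/-- The function t = log|x - u| - log R is at most log 2 on the circle, so |t| ≤ 2 log 2 - t, and t
has mean zero because u lies in the closed disk. -/
theorem circleAverage_abs_log_norm_sub_sub_log_le {R : ℝ} (hR : 1 ≤ R) {u : ℂ} (hu : ‖u‖ ≤ R) :
    circleAverage (fun x => |log ‖x - u‖ - log R|) 0 R ≤ 2 := by
  have hR0 : 0 < R := by linarith
  have hi := circleIntegrable_log_norm_sub u R
  have h2 : log 2 ≤ 1 := by linarith [log_two_lt_d9]
  have key : circleAverage (fun x => |log ‖x - u‖ - log R|) 0 R ≤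
      circleAverage (fun x => (2 * log 2 + log R) - log ‖x - u‖) 0 R := by
    refine circleAverage_mono (hi.sub (circleIntegrable_const _ _ _)).abs
      ((circleIntegrable_const _ _ _).sub hi) fun x hx => ?_
    rw [abs_of_pos hR0, mem_sphere_zero_iff_norm] at hx
    have : log ‖x - u‖ ≤ log 2 + log R := by
      apply log_le_of_le_exp (norm_nonneg _)
      · have := log_nonneg hR
        have := log_pos one_lt_two
        linarith
      · rw [exp_add, exp_log two_pos, exp_log hR0]
        have := norm_sub_le x u
        linarith
    have := log_pos one_lt_two
    rw [abs_le]
    constructor <;> linarith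
  refine key.trans ?_
  rw [circleAverage_fun_sub (circleIntegrable_const _ _ _) hi, circleAverage_const,
    circleAverage_log_norm_sub_const_of_mem_closedBall (by simpa [abs_of_pos hR0] using hu)]
  linarith

theorem log_add_le_circleAverage_log_norm_sub {r : ℝ} (hr : 0 < r) (u : ℂ) :
    log (r + ‖u‖) - log 2 ≤ circleAverage (fun x => log ‖x - u‖) 0 r := by
  have h2 : (r + ‖u‖) / 2 ≤ max r ‖u‖ := by
    have := le_max_left r ‖u‖
    have := le_max_right r ‖u‖
    linarith
  have hp : 0 < r + ‖u‖ := by positivity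
  rw [circleAverage_log_norm_sub_const_eq_log_radius_add_posLog hr.ne', zero_sub, norm_neg,
    ← log_div hp.ne' two_ne_zero, posLog_eq_log_max_one (by positivity),
    ← log_mul hr.ne' (by positivity), mul_max_of_nonneg _ _ hr.le, mul_one,
    mul_inv_cancel_left₀ hr.ne']
  exact log_le_log (by positivity) h2

/-- A map of the circle of radius `r` that does not contract distances too much. -/
structure IsCircleShift (c L r : ℝ) (w : ℂ → ℂ) : Prop where
  analytic : AnalyticOnNhd ℂ w (sphere 0 r)
  deriv_ne_zero : ∀ x ∈ sphere (0 : ℂ) r, deriv w x ≠ 0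
  norm_le : ∀ x ∈ sphere (0 : ℂ) r, ‖w x‖ ≤ L * r
  expand : ∀ x ∈ sphere (0 : ℂ) r, ∀ y ∈ sphere (0 : ℂ) r, c * ‖x - y‖ ≤ ‖w x - w y‖

/-- If |u| ≥ 2Lr, then u is far from the image of the circle and the bound is pointwise. Otherwise
let y on the circle minimise |w(y) - u|; then c|x - y| ≤ |w(x) - w(y)| ≤ 2|w(x) - u|, and log|x - y|
has mean log r. -/
theorem IsCircleShift.log_add_le_circleAverage {c L r : ℝ} {w : ℂ → ℂ} (hw : IsCircleShift c L r w)
    (hc : 0 < c) (hL : 1 ≤ L) (hr : 0 < r) (u : ℂ) :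
    log (r + ‖u‖) - (log 4 + log (1 + 2 * L) + |log (c / 2)|)
      ≤ circleAverage (fun x => log ‖w x - u‖) 0 r := by
  have hm : MeromorphicOn (fun x => w x - u) (sphere 0 |r|) := by
    rw [abs_of_pos hr]
    exact (hw.analytic.sub analyticOnNhd_const).meromorphicOn
  have hi : CircleIntegrable (fun x => log ‖w x - u‖) 0 r := hm.circleIntegrable_log_norm
  have hp : 0 < r + ‖u‖ := by positivity
  have l4 : 0 ≤ log 4 := log_nonneg (by norm_num)
  have lL : 0 ≤ log (1 + 2 * L) := log_nonneg (by linarith)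
  rcases le_or_gt (2 * L * r) ‖u‖ with hu | hu
  · have : log (r + ‖u‖) - log 4 ≤ circleAverage (fun x => log ‖w x - u‖) 0 r := by
      rw [← circleAverage_const (log (r + ‖u‖) - log 4) 0 r]
      refine circleAverage_mono (circleIntegrable_const _ _ _) hi fun x hx => ?_
      rw [abs_of_pos hr] at hx
      have h1 := hw.norm_le x hx
      have h2 := norm_sub_norm_le u (w x)
      rw [norm_sub_rev] at h2
      rw [← log_div hp.ne' (by norm_num)]
      refine log_le_log (by positivity) ?_
      nlinarith
    linarith [abs_nonneg (log (c / 2))]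
  · have hcont : ContinuousOn (fun x => ‖w x - u‖) (sphere 0 r) :=
      (hw.analytic.continuousOn.sub continuousOn_const).norm
    obtain ⟨y, hy, hmin⟩ := (isCompact_sphere (0 : ℂ) r).exists_isMinOn
      (NormedSpace.sphere_nonempty.2 hr.le) hcont
    have hmono : circleAverage (fun x => log (c / 2) + log ‖x - y‖) 0 r
        ≤ circleAverage (fun x => log ‖w x - u‖) 0 r := by
      refine circleAverage_mono_codiscreteWithin hr.ne'
        ((circleIntegrable_const _ _ _).add (circleIntegrable_log_norm_sub y r)) hi ?_
      have hne : {x : ℂ | x ≠ y} ∈ codiscreteWithin (sphere (0 : ℂ) |r|) := by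
        refine codiscreteWithin_mono (subset_univ _) ?_
        exact (finite_singleton y).compl_mem_codiscrete
      filter_upwards [hne, self_mem_codiscreteWithin _] with x hxy hx
      rw [abs_of_pos hr] at hx
      have h0 : 0 < ‖x - y‖ := norm_pos_iff.2 (sub_ne_zero.2 hxy)
      rw [← log_mul (by positivity) h0.ne']
      refine log_le_log (by positivity) ?_
      have h1 := hw.expand x hx y hy
      have h2 : ‖w y - u‖ ≤ ‖w x - u‖ := hmin hx
      have h3 : ‖w x - w y‖ ≤ ‖w x - u‖ + ‖w y - u‖ := by
        have := norm_sub_le (w x - u) (w y - u)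
        simpa using this
      linarith
    have hyr : y ∈ closedBall (0 : ℂ) |r| := by
      rw [abs_of_pos hr]
      exact sphere_subset_closedBall hy
    rw [circleAverage_fun_add (circleIntegrable_const _ _ _) (circleIntegrable_log_norm_sub y r),
      circleAverage_const, circleAverage_log_norm_sub_const_of_mem_closedBall hyr] at hmono
    have h5 : log (r + ‖u‖) ≤ log (1 + 2 * L) + log r := by
      rw [← log_mul (by positivity) hr.ne']
      refine log_le_log hp ?_
      nlinarith
    linarith [neg_abs_le (log (c / 2))]

/-- Both logarithms are at most M = log L + log(r + |u|), so their difference is at most 2M minus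
their sum in absolute value, while both means are at least log(r + |u|) - O(1). The bound is uniform
in r and u, so it can be summed over zeros and poles. -/
theorem IsCircleShift.circleAverage_abs_log_sub_log_le {c L r : ℝ} {w : ℂ → ℂ}
    (hw : IsCircleShift c L r w) (hc : 0 < c) (hL : 1 ≤ L) (hr : 1 ≤ r) (u : ℂ) :
    circleAverage (fun x => |log ‖w x - u‖ - log ‖x - u‖|) 0 r ≤
      2 * log L + log 2 + (log 4 + log (1 + 2 * L) + |log (c / 2)|) := by
  have hr0 : 0 < r := by linarith
  have hm : MeromorphicOn (fun x => w x - u) (sphere 0 |r|) := by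
    rw [abs_of_pos hr0]
    exact (hw.analytic.sub analyticOnNhd_const).meromorphicOn
  have hi : CircleIntegrable (fun x => log ‖w x - u‖) 0 r := hm.circleIntegrable_log_norm
  have hi' := circleIntegrable_log_norm_sub u r
  have hp : 0 < r + ‖u‖ := by positivity
  set M := log L + log (r + ‖u‖) with hM
  have hM0 : 0 ≤ M := add_nonneg (log_nonneg hL) (log_nonneg (by linarith [norm_nonneg u]))
  have hexp : exp M = L * (r + ‖u‖) := by rw [exp_add, exp_log (by linarith), exp_log hp]
  have key : circleAverage (fun x => |log ‖w x - u‖ - log ‖x - u‖|) 0 r ≤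
      circleAverage (fun x => 2 * M - log ‖w x - u‖ - log ‖x - u‖) 0 r := by
    refine circleAverage_mono (hi.sub hi').abs
      (((circleIntegrable_const _ _ _).sub hi).sub hi') fun x hx => ?_
    rw [abs_of_pos hr0] at hx
    have h1 := hw.norm_le x hx
    rw [mem_sphere_zero_iff_norm] at hx
    have a1 : log ‖w x - u‖ ≤ M := by
      refine log_le_of_le_exp (norm_nonneg _) hM0 (hexp ▸ (norm_sub_le _ _).trans ?_)
      nlinarith [norm_nonneg u]
    have a2 : log ‖x - u‖ ≤ M := by
      refine log_le_of_le_exp (norm_nonneg _) hM0 (hexp ▸ (norm_sub_le _ _).trans ?_)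
      nlinarith [norm_nonneg u]
    rw [abs_le]
    constructor <;> linarith
  refine key.trans ?_
  rw [circleAverage_fun_sub (f₁ := fun x => 2 * M - log ‖w x - u‖)
      ((circleIntegrable_const _ _ _).sub hi) hi',
    circleAverage_fun_sub (circleIntegrable_const _ _ _) hi, circleAverage_const]
  have b1 := hw.log_add_le_circleAverage hc hL hr0 u
  have b2 := log_add_le_circleAverage_log_norm_sub hr0 u
  linarith

end AskeyWilsonGrowth


/-! ### Zeros and poles, and the mean change of log|f| under a shift -/

namespace AskeyWilsonGrowth

open Real Metric Function Topology

open MeromorphicOn in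
/-- The number of zeros and poles of `f` in the closed disk of radius `R`. -/
noncomputable def zeroPoleCount (f : ℂ → ℂ) (R : ℝ) : ℝ :=
  ∑ᶠ u, |(divisor f (closedBall 0 R) u : ℝ)|

theorem logCounting_eq_sum (D : locallyFinsupp ℂ ℤ) {R : ℝ} (hR : 0 < R)
    (F : Finset ℂ) (hF : ∀ y ∈ F, ‖y‖ ≤ R) (hD : ∀ y, ‖y‖ ≤ R → D y ≠ 0 → y ∈ F) :
    locallyFinsuppWithin.logCounting D R = ∑ y ∈ F, D y * (log R - log ‖y‖) := by
  have hfin : (locallyFinsuppWithin.toClosedBall R D).support.Finite :=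
    locallyFinsuppWithin.finiteSupport _ (isCompact_closedBall 0 |R|)
  have mem : ∀ y : ℂ, ‖y‖ ≤ R → y ∈ closedBall (0 : ℂ) |R| := fun y hy => by
    simpa [abs_of_pos hR] using hy
  have h0 : locallyFinsuppWithin.toClosedBall R D 0 = D 0 :=
    locallyFinsuppWithin.toClosedBall_eval_within D (mem 0 (by simpa using hR.le))
  have key := countingFunction_finsum_eq_finsum_add (c := 0) hR.ne' hfin
  simp only [zero_sub, norm_neg, h0] at key
  -- The origin needs no separate term on the right: since `log 0 = 0`, its summand is exactly `D 0
  -- * log R`.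
  change ∑ᶠ z, (locallyFinsuppWithin.toClosedBall R D z : ℝ) * log (R * ‖z‖⁻¹) + (D 0) * log R = _
  rw [← key, finsum_eq_sum_of_support_subset (s := F)]
  · exact Finset.sum_congr rfl fun y hy => by
      rw [locallyFinsuppWithin.toClosedBall_eval_within D (mem y (hF y hy))]
  · intro y hy
    have hy1 : locallyFinsuppWithin.toClosedBall R D y ≠ 0 := fun h => by
      rw [mem_support, h] at hy
      simp at hy
    have hy2 : ‖y‖ ≤ R := by
      have := locallyFinsuppWithin.toClosedBall_support_subset_closedBall D hy1
      simpa [abs_of_pos hR] using this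
    rw [locallyFinsuppWithin.toClosedBall_eval_within D (mem y hy2)] at hy1
    exact hD y hy2 hy1

theorem exists_finset_support (D : locallyFinsupp ℂ ℤ) {R : ℝ} (hR : 0 < R) :
    ∃ F : Finset ℂ, (∀ y ∈ F, ‖y‖ ≤ R) ∧ ∀ y, ‖y‖ ≤ R → D y ≠ 0 → y ∈ F := by
  have hfin : (locallyFinsuppWithin.toClosedBall R D).support.Finite :=
    locallyFinsuppWithin.finiteSupport _ (isCompact_closedBall 0 |R|)
  refine ⟨hfin.toFinset, fun y hy => ?_, fun y hy h => ?_⟩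
  · rw [Finite.mem_toFinset] at hy
    have := locallyFinsuppWithin.toClosedBall_support_subset_closedBall D hy
    simpa [abs_of_pos hR] using this
  · rw [Finite.mem_toFinset, mem_support,
      locallyFinsuppWithin.toClosedBall_eval_within D (by simpa [abs_of_pos hR] using hy)]
    exact h

/-- The condition `1 ≤ R` takes care of y = 0, where `log 0 = 0`. -/
theorem log_norm_le_log {R : ℝ} (hR : 1 ≤ R) {y : ℂ} (hy : ‖y‖ ≤ R) : log ‖y‖ ≤ log R :=
  log_le_of_le_exp (norm_nonneg _) (log_nonneg hR) (by rwa [exp_log (by linarith)])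

theorem sum_le_logCounting {D : locallyFinsupp ℂ ℤ} (hD : 0 ≤ D) {R : ℝ} (hR : 1 ≤ R)
    (F : Finset ℂ) (hF : ∀ y ∈ F, ‖y‖ ≤ R) :
    ∑ y ∈ F, D y * (log R - log ‖y‖) ≤ locallyFinsuppWithin.logCounting D R := by
  classical
  obtain ⟨G, hG, hG'⟩ := exists_finset_support D (by linarith : 0 < R)
  have hu : ∀ y ∈ F ∪ G, ‖y‖ ≤ R := fun y hy => by
    rcases Finset.mem_union.1 hy with h | h
    exacts [hF y h, hG y h]
  rw [logCounting_eq_sum D (by linarith) (F ∪ G) hu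
    fun y hy h => Finset.mem_union_right _ (hG' y hy h)]
  refine Finset.sum_le_sum_of_subset_of_nonneg Finset.subset_union_left fun y hy _ => ?_
  have := log_norm_le_log hR (hu y hy)
  have h0 : (0 : ℝ) ≤ D y := by exact_mod_cast hD y
  exact mul_nonneg h0 (by linarith)

open ValueDistribution MeromorphicOn in
-- Each zero or pole of modulus at most R contributes at least log S - log R, with multiplicity, to
-- the counting functions at S.
theorem zeroPoleCount_mul_log_le {f : ℂ → ℂ} (hf : Meromorphic f) {R S : ℝ} (hR : 1 ≤ R)
    (hS : R ≤ S) :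
    zeroPoleCount f R * (log S - log R) ≤ logCounting f ⊤ S + logCounting f 0 S := by
  have hfin : (divisor f (closedBall 0 R)).support.Finite :=
    (divisor f (closedBall 0 R)).finiteSupport (isCompact_closedBall 0 R)
  have hF : ∀ y ∈ hfin.toFinset, ‖y‖ ≤ R := fun y hy => by
    rw [Finite.mem_toFinset] at hy
    simpa using (divisor f (closedBall 0 R)).supportWithinDomain hy
  have hn : zeroPoleCount f R = ∑ y ∈ hfin.toFinset, |(divisor f univ y : ℝ)| := by
    rw [zeroPoleCount, finsum_eq_sum_of_support_subset (s := hfin.toFinset)]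
    · refine Finset.sum_congr rfl fun y hy => ?_
      rw [divisor_apply hf.meromorphicOn (by simpa using hF y hy),
        divisor_apply hf.meromorphicOn (mem_univ y)]
    · intro y hy
      simpa using hy
  have h1 := sum_le_logCounting (negPart_nonneg (divisor f univ)) (hR.trans hS) hfin.toFinset
    fun y hy => (hF y hy).trans hS
  have h2 := sum_le_logCounting (posPart_nonneg (divisor f univ)) (hR.trans hS) hfin.toFinset
    fun y hy => (hF y hy).trans hS
  rw [logCounting_top, logCounting_zero]
  refine le_trans ?_ (add_le_add h1 h2)
  rw [hn, Finset.sum_mul, ← Finset.sum_add_distrib]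
  refine Finset.sum_le_sum fun y hy => ?_
  have e : |(divisor f univ y : ℝ)| = (((divisor f univ)⁻ y : ℤ) : ℝ) + ((divisor f univ)⁺ y : ℤ) := by
    have : |divisor f univ y| = (divisor f univ)⁻ y + (divisor f univ)⁺ y := by
      rw [locallyFinsuppWithin.negPart_apply, locallyFinsuppWithin.posPart_apply, add_comm,
        posPart_add_negPart]
    exact_mod_cast this
  rw [← add_mul, ← e]
  have := log_norm_le_log hR (hF y hy)
  exact mul_le_mul_of_nonneg_left (by linarith) (abs_nonneg _)

theorem zeroPoleCount_nonneg (f : ℂ → ℂ) (R : ℝ) : 0 ≤ zeroPoleCount f R :=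
  finsum_nonneg fun _ => abs_nonneg _

/-- With non-vanishing derivative, w is nowhere locally constant, so preimages of exceptional
discrete sets are discrete. This transports the factorisation of f from x to w(x). -/
theorem IsCircleShift.tendsto_codiscreteWithin {c L r : ℝ} {w : ℂ → ℂ}
    (hw : IsCircleShift c L r w) {U : Set ℂ} (hU : MapsTo w (sphere 0 r) U) :
    Tendsto w (codiscreteWithin (sphere 0 r)) (codiscreteWithin U) := by
  refine le_trans (hw.analytic.map_codiscreteWithin fun x hx h => hw.deriv_ne_zero x hx ?_)
    (codiscreteWithin_mono hU.image_subset)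
  obtain ⟨b, hb⟩ := eventuallyConst_iff_exists_eventuallyEq.1 h
  simpa using hb.deriv_eq

open ValueDistribution MeromorphicOn in
-- Poisson–Jensen in disguise: on the disk of radius R, log|f| splits into a harmonic h and
-- potentials of the divisor. The change of h is bounded by `abs_harmonic_sub_le`, that of the
-- potentials by `IsCircleShift.circleAverage_abs_log_sub_log_le`.
theorem circleAverage_abs_log_shift_le {f : ℂ → ℂ} (hf : Meromorphic f)
    (hne : ∀ z, meromorphicOrderAt f z ≠ ⊤) {c L r R : ℝ} (hc : 0 < c) (hL : 1 ≤ L) (hr : 1 ≤ r)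
    (hR : 2 * L * r ≤ R) {w : ℂ → ℂ} (hw : IsCircleShift c L r w) :
    circleAverage (fun x => |log ‖f (w x)‖ - log ‖f x‖|) 0 r ≤
      16 * L * (r / R) * (proximity f ⊤ R + proximity f⁻¹ ⊤ R) +
      (16 + (2 * log L + log 2 + (log 4 + log (1 + 2 * L) + |log (c / 2)|))) *
        zeroPoleCount f R := by
  set K := 2 * log L + log 2 + (log 4 + log (1 + 2 * L) + |log (c / 2)|) with hK
  have hr0 : 0 < r := by linarith
  have hR1 : 1 ≤ R := by nlinarith
  have hR0 : 0 < R := by linarith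
  have hrR : r ≤ R / 2 := by nlinarith
  set D := divisor f (closedBall 0 R) with hDdef
  have hfin : D.support.Finite := D.finiteSupport (isCompact_closedBall 0 R)
  have hF : ∀ y ∈ hfin.toFinset, ‖y‖ ≤ R := fun y hy => by
    rw [Finite.mem_toFinset] at hy
    simpa using D.supportWithinDomain hy
  have hn : zeroPoleCount f R = ∑ y ∈ hfin.toFinset, |(D y : ℝ)| :=
    finsum_eq_sum_of_support_subset _ fun y hy => by simpa using hy
  obtain ⟨g, hg, hg0, hfg⟩ := MeromorphicOn.extract_zeros_poles (U := closedBall 0 R)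
    hf.meromorphicOn (fun u => hne u) hfin
  have hlog := MeromorphicOn.extract_zeros_poles_log hg0 hfg
  -- Adding the constants `D y * log R` normalises each potential to log(|x - y|/R), whose absolute
  -- mean on the large circle is at most 2.
  set h : ℂ → ℝ := fun x => log ‖g x‖ + ∑ y ∈ hfin.toFinset, D y * log R with hh
  have hharm : InnerProductSpace.HarmonicOnNhd h (closedBall 0 R) :=
    InnerProductSpace.HarmonicOnNhd.add
      (fun x hx => (hg x hx).harmonicAt_log_norm (hg0 ⟨x, hx⟩))
      (InnerProductSpace.harmonicOnNhd_const _)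
  have hid : ∀ᶠ x in codiscreteWithin (closedBall (0 : ℂ) R),
      log ‖f x‖ = h x + ∑ y ∈ hfin.toFinset, D y * (log ‖x - y‖ - log R) := by
    filter_upwards [hlog] with x hx
    rw [hx, Pi.add_apply, finsum_eq_sum_of_support_subset (s := hfin.toFinset), Finset.sum_apply,
      hh]
    · simp only [mul_sub, Finset.sum_sub_distrib]
      change ∑ y ∈ hfin.toFinset, (D y : ℝ) * log ‖x - y‖ + _ = _
      ring
    · intro y hy
      rw [mem_support] at hy
      simp only [Finite.coe_toFinset, mem_support]
      rintro h0
      apply hy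
      ext
      simp [← hDdef, h0]
  -- the average of `|h|` on the large circle
  have hmean : circleAverage (fun ζ => |h ζ|) 0 R ≤
      proximity f ⊤ R + proximity f⁻¹ ⊤ R + 2 * zeroPoleCount f R := by
    have hs : sphere (0 : ℂ) |R| ⊆ closedBall 0 R := by
      rw [abs_of_pos hR0]
      exact sphere_subset_closedBall
    have i1 : CircleIntegrable (fun ζ => |h ζ|) 0 R :=
      ContinuousOn.circleIntegrable' (hharm.continuousOn.mono hs).abs
    have i2 : CircleIntegrable (fun ζ => log⁺ ‖f ζ‖) 0 R :=
      hf.meromorphicOn.circleIntegrable_posLog_norm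
    have i3 : CircleIntegrable (fun ζ => log⁺ ‖f⁻¹ ζ‖) 0 R :=
      hf.inv.meromorphicOn.circleIntegrable_posLog_norm
    have i4 : ∀ y ∈ hfin.toFinset,
        CircleIntegrable (fun ζ => |(D y : ℝ)| * |log ‖ζ - y‖ - log R|) 0 R := fun y _ =>
      (((circleIntegrable_log_norm_sub y R).sub (circleIntegrable_const _ _ _)).abs).const_fun_smul
    have i5 : CircleIntegrable
        (fun ζ => ∑ y ∈ hfin.toFinset, |(D y : ℝ)| * |log ‖ζ - y‖ - log R|) 0 R :=
      CircleIntegrable.fun_sum _ i4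
    calc circleAverage (fun ζ => |h ζ|) 0 R
        ≤ circleAverage (fun ζ => log⁺ ‖f ζ‖ + log⁺ ‖f⁻¹ ζ‖ +
            ∑ y ∈ hfin.toFinset, |(D y : ℝ)| * |log ‖ζ - y‖ - log R|) 0 R := by
          refine circleAverage_mono_codiscreteWithin hR0.ne' i1 ((i2.add i3).add i5) ?_
          filter_upwards [hid.filter_mono (codiscreteWithin_mono hs)] with x hx
          have e1 : h x = log ‖f x‖ - ∑ y ∈ hfin.toFinset, D y * (log ‖x - y‖ - log R) := by
            rw [hx]
            ring
          have e2 := abs_log_eq_posLog_add_posLog_inv ‖f x‖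
          rw [e1, Pi.inv_apply, norm_inv, ← e2]
          refine (abs_sub _ _).trans (add_le_add le_rfl
            ((Finset.abs_sum_le_sum_abs _ _).trans_eq ?_))
          simp only [abs_mul]
      _ = proximity f ⊤ R + proximity f⁻¹ ⊤ R + ∑ y ∈ hfin.toFinset,
            |(D y : ℝ)| * circleAverage (fun ζ => |log ‖ζ - y‖ - log R|) 0 R := by
          rw [circleAverage_fun_add (f₁ := fun ζ => log⁺ ‖f ζ‖ + log⁺ ‖f⁻¹ ζ‖) (i2.add i3) i5,
            circleAverage_fun_add i2 i3, circleAverage_fun_sum i4, proximity_top, proximity_top]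
          simp only [← smul_eq_mul, circleAverage_fun_smul]
      _ ≤ _ := by
          rw [hn, Finset.mul_sum]
          refine add_le_add le_rfl (Finset.sum_le_sum fun y hy => ?_)
          rw [mul_comm]
          exact mul_le_mul_of_nonneg_right
            (circleAverage_abs_log_norm_sub_sub_log_le hR1 (hF y hy)) (abs_nonneg _)
  have hprox : 0 ≤ proximity f ⊤ R + proximity f⁻¹ ⊤ R :=
    add_nonneg (proximity_nonneg R) (proximity_nonneg R)
  have hcount := zeroPoleCount_nonneg f R
  set A := 16 * L * (r / R) * (proximity f ⊤ R + proximity f⁻¹ ⊤ R + 2 * zeroPoleCount f R) with hA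
  have hmaps : MapsTo w (sphere 0 r) (closedBall 0 R) := fun x hx => by
    have := hw.norm_le x hx
    rw [mem_closedBall_zero_iff]
    nlinarith
  have hm : ∀ y : ℂ, CircleIntegrable (fun x => log ‖w x - y‖) 0 r := fun y =>
    MeromorphicOn.circleIntegrable_log_norm (f := fun x => w x - y) (by
      rw [abs_of_pos hr0]
      exact (hw.analytic.sub analyticOnNhd_const).meromorphicOn)
  have j1 : CircleIntegrable (fun x => log ‖f (w x)‖) 0 r :=
    MeromorphicOn.circleIntegrable_log_norm (f := fun x => f (w x)) (by
      rw [abs_of_pos hr0]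
      exact fun x hx => (hf (w x)).comp_analyticAt (hw.analytic x hx))
  have j2 : CircleIntegrable (fun x => log ‖f x‖) 0 r :=
    hf.meromorphicOn.circleIntegrable_log_norm
  have j3 : ∀ y ∈ hfin.toFinset,
      CircleIntegrable (fun x => |(D y : ℝ)| * |log ‖w x - y‖ - log ‖x - y‖|) 0 r := fun y _ =>
    ((hm y).sub (circleIntegrable_log_norm_sub y r)).abs.const_fun_smul
  have j4 : CircleIntegrable
      (fun x => ∑ y ∈ hfin.toFinset, |(D y : ℝ)| * |log ‖w x - y‖ - log ‖x - y‖|) 0 r :=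
    CircleIntegrable.fun_sum _ j3
  calc circleAverage (fun x => |log ‖f (w x)‖ - log ‖f x‖|) 0 r
      ≤ circleAverage (fun x => A + ∑ y ∈ hfin.toFinset,
          |(D y : ℝ)| * |log ‖w x - y‖ - log ‖x - y‖|) 0 r := by
        refine circleAverage_mono_codiscreteWithin hr0.ne' (j1.sub j2).abs
          ((circleIntegrable_const _ _ _).add j4) ?_
        rw [abs_of_pos hr0]
        have hid' := hid.filter_mono (codiscreteWithin_mono
          (sphere_subset_closedBall.trans (closedBall_subset_closedBall (by linarith : r ≤ R))))
        filter_upwards [hid', (hw.tendsto_codiscreteWithin hmaps).eventually hid,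
          self_mem_codiscreteWithin _] with x hx hwx hxs
        have hnw := hw.norm_le x hxs
        rw [mem_sphere_zero_iff_norm] at hxs
        have e : log ‖f (w x)‖ - log ‖f x‖ = (h (w x) - h x) +
            ∑ y ∈ hfin.toFinset, D y * (log ‖w x - y‖ - log ‖x - y‖) := by
          rw [hx, hwx]
          simp only [mul_sub, Finset.sum_sub_distrib]
          ring
        rw [e]
        refine (abs_add_le _ _).trans (add_le_add ?_
          ((Finset.abs_sum_le_sum_abs _ _).trans_eq (by simp only [abs_mul])))
        refine (abs_harmonic_sub_le hR0 hharm (by linarith) (by nlinarith)).trans ?_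
        have hd : ‖w x - x‖ ≤ 2 * L * r := by
          refine (norm_sub_le _ _).trans ?_
          nlinarith
        calc 8 * ‖w x - x‖ / R * circleAverage (fun ζ => |h ζ|) 0 R
            ≤ 8 * (2 * L * r) / R *
              (proximity f ⊤ R + proximity f⁻¹ ⊤ R + 2 * zeroPoleCount f R) := by
              have : 0 ≤ circleAverage (fun ζ => |h ζ|) 0 R :=
                circleAverage_nonneg_of_nonneg fun _ _ => abs_nonneg _
              gcongr
          _ = A := by
              rw [hA]
              ring
    _ = A + ∑ y ∈ hfin.toFinset,
          |(D y : ℝ)| * circleAverage (fun x => |log ‖w x - y‖ - log ‖x - y‖|) 0 r := by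
        rw [circleAverage_fun_add (circleIntegrable_const _ _ _) j4, circleAverage_const,
          circleAverage_fun_sum j3]
        simp only [← smul_eq_mul, circleAverage_fun_smul]
    _ ≤ A + K * zeroPoleCount f R := by
        rw [hn, Finset.mul_sum]
        refine add_le_add le_rfl (Finset.sum_le_sum fun y hy => ?_)
        rw [mul_comm]
        exact mul_le_mul_of_nonneg_right (hw.circleAverage_abs_log_sub_log_le hc hL hr y)
          (abs_nonneg _)
    _ ≤ _ := by
        -- This turns the term `2 * zeroPoleCount f R` inside `A` into the summand 16 of the final
        -- coefficient.
        have : L * (r / R) ≤ 1 / 2 := by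
          rw [← mul_div_assoc, div_le_div_iff₀ hR0 two_pos]
          linarith
        rw [hA]
        nlinarith

end AskeyWilsonGrowth


/-! ### Minimal growth of non-constant functions, and the logarithmic difference estimate -/

namespace AskeyWilsonGrowth

open Real Metric Function Topology ValueDistribution MeromorphicOn

theorem codiscrete_eventuallyEq_zero_of_order_eq_top {f : ℂ → ℂ} (hf : Meromorphic f) {z : ℂ}
    (h : meromorphicOrderAt f z = ⊤) : f =ᶠ[codiscrete ℂ] 0 := by
  have hall : ∀ x, meromorphicOrderAt f x = ⊤ := by
    by_contra! hx
    obtain ⟨x, hx⟩ := hx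
    have h1 := (MeromorphicOn.exists_meromorphicOrderAt_ne_top_iff_forall (hf.meromorphicOn (s := univ))
      isConnected_univ).1 ⟨⟨x, mem_univ x⟩, hx⟩ ⟨z, mem_univ z⟩
    exact h1 h
  rw [EventuallyEq, Filter.Eventually, mem_codiscrete]
  intro x
  rw [disjoint_principal_right, compl_compl]
  exact meromorphicOrderAt_eq_top_iff.1 (hall x)

theorem order_sub_const_ne_top {f : ℂ → ℂ} (hf : IsNonconstantMeromorphic f) (c z : ℂ) :
    meromorphicOrderAt (fun x => f x - c) z ≠ ⊤ := fun h => by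
  have hm : Meromorphic (fun x => f x - c) := hf.1.sub (.const c)
  refine hf.2 ⟨c, ?_⟩
  filter_upwards [codiscrete_eventuallyEq_zero_of_order_eq_top hm h] with x hx
  simpa [sub_eq_zero] using hx

theorem order_ne_top {f : ℂ → ℂ} (hf : IsNonconstantMeromorphic f) (z : ℂ) :
    meromorphicOrderAt f z ≠ ⊤ := by
  simpa using order_sub_const_ne_top hf 0 z

theorem log_le_logCounting_zero {f : ℂ → ℂ} (hf : Meromorphic f) (h0 : 0 < meromorphicOrderAt f 0)
    (htop : meromorphicOrderAt f 0 ≠ ⊤) {r : ℝ} (hr : 1 ≤ r) : log r ≤ logCounting f 0 r := by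
  have h1 := sum_le_logCounting (posPart_nonneg (divisor f univ)) hr {0}
    (by simpa using by linarith)
  have hd : 1 ≤ (divisor f univ)⁺ 0 := by
    rw [locallyFinsuppWithin.posPart_apply, divisor_apply hf.meromorphicOn (mem_univ 0)]
    refine le_trans ?_ (le_posPart _)
    lift meromorphicOrderAt f 0 to ℤ using htop with m hm
    rw [WithTop.untop₀_coe]
    exact_mod_cast h0
  have hd' : (1 : ℝ) ≤ ((divisor f univ)⁺ 0 : ℤ) := by exact_mod_cast hd
  rw [logCounting_zero]
  simp only [Finset.sum_singleton, norm_zero, log_zero, sub_zero] at h1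
  have := log_nonneg hr
  nlinarith

theorem characteristic_inv_le {f : ℂ → ℂ} (hf : Meromorphic f) :
    ∃ K : ℝ, 0 ≤ K ∧ ∀ r, characteristic f⁻¹ ⊤ r ≤ characteristic f ⊤ r + K := by
  refine ⟨max |log ‖f 0‖| |log ‖meromorphicTrailingCoeffAt f 0‖|,
    (abs_nonneg _).trans (le_max_left _ _), fun r => ?_⟩
  have := (abs_le.1 (characteristic_sub_characteristic_inv_le (R := r) hf)).1
  linarith

/-- A pole at the origin already contributes log r. Otherwise subtract the limit b of f at 0: then f
- b vanishes at 0, its zero contributes log r, and the first main theorem returns to f. Later this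
absorbs additive constants and O(log r) terms into the characteristic. -/
theorem log_sub_le_characteristic {f : ℂ → ℂ} (hf : IsNonconstantMeromorphic f) :
    ∃ K : ℝ, ∀ r, 1 ≤ r → log r - K ≤ characteristic f ⊤ r := by
  rcases lt_or_ge (meromorphicOrderAt f 0) 0 with hneg | hpos
  · refine ⟨0, fun r hr => ?_⟩
    have h1 := log_le_logCounting_zero hf.1.inv (f := f⁻¹) (by
      rw [meromorphicOrderAt_inv]
      lift meromorphicOrderAt f 0 to ℤ using order_ne_top hf 0 with m
      have : m < 0 := by exact_mod_cast hneg
      exact_mod_cast (by omega : 0 < -m)) (by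
      rw [meromorphicOrderAt_inv]
      lift meromorphicOrderAt f 0 to ℤ using order_ne_top hf 0 with m
      exact WithTop.coe_ne_top) hr
    rw [← logCounting_inv, inv_inv] at h1
    have h2 : 0 ≤ proximity f ⊤ r := proximity_nonneg r
    rw [characteristic, Pi.add_apply]
    linarith
  · obtain ⟨b, hb⟩ := tendsto_nhds_of_meromorphicOrderAt_nonneg (hf.1 0) hpos
    set g : ℂ → ℂ := fun x => f x - b with hg
    have hgm : Meromorphic g := hf.1.sub (.const b)
    have hgt : Tendsto g (𝓝[≠] 0) (𝓝 0) := by simpa [hg] using hb.sub_const b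
    have hgo : 0 < meromorphicOrderAt g 0 :=
      (tendsto_zero_iff_meromorphicOrderAt_pos (hgm 0)).1 hgt
    obtain ⟨K, -, hK⟩ := characteristic_inv_le hgm
    refine ⟨K + (log⁺ ‖b‖ + log 2), fun r hr => ?_⟩
    have h1 := log_le_logCounting_zero hgm hgo (order_sub_const_ne_top hf b 0) hr
    have h2 := hK r
    have h3 := (abs_le.1 (abs_characteristic_sub_characteristic_shift_le (a₀ := b) (r := r) hf.1)).1
    have h4 : 0 ≤ proximity g⁻¹ ⊤ r := proximity_nonneg r
    rw [characteristic, Pi.add_apply, logCounting_inv] at h2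
    change _ ≤ _ - characteristic g ⊤ r at h3
    linarith

theorem eventually_log_le_two_mul_characteristic {f : ℂ → ℂ} (hf : IsNonconstantMeromorphic f) :
    ∃ r₀ : ℝ, 3 ≤ r₀ ∧ ∀ r, r₀ ≤ r →
      log r ≤ 2 * characteristic f ⊤ r ∧ 1 ≤ 2 * characteristic f ⊤ r := by
  obtain ⟨K, hK⟩ := log_sub_le_characteristic hf
  refine ⟨max 3 (exp (2 * K)), le_max_left _ _, fun r hr => ?_⟩
  have h3 : 3 ≤ r := (le_max_left _ _).trans hr
  have h1 : 2 * K ≤ log r := by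
    rw [le_log_iff_exp_le (by linarith)]
    exact (le_max_right _ _).trans hr
  have h2 := hK r (by linarith)
  have h4 : 1 ≤ log r := by
    rw [le_log_iff_exp_le (by linarith)]
    linarith [exp_one_lt_d9]
  constructor <;> linarith

/-- The analogue for shifts of the lemma on the logarithmic derivative. Leaving S free is what
allows a gain of log(S/r) in the entire case. -/
theorem exists_circleAverage_abs_log_shift_le {f : ℂ → ℂ} (hf : IsNonconstantMeromorphic f)
    {c L : ℝ} (hc : 0 < c) (hL : 1 ≤ L) :
    ∃ C r₀ : ℝ, 0 ≤ C ∧ ∀ r S : ℝ, r₀ ≤ r → 4 * L ^ 2 * r ≤ S → ∀ w : ℂ → ℂ,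
      IsCircleShift c L r w →
      circleAverage (fun x => |log ‖f (w x)‖ - log ‖f x‖|) 0 r
        ≤ C * (characteristic f ⊤ S / log (S / r)) := by
  obtain ⟨K, hK0, hK⟩ := characteristic_inv_le hf.1
  obtain ⟨r₀, hr₀, hlow⟩ := eventually_log_le_two_mul_characteristic hf
  set K₁ := 16 + (2 * log L + log 2 + (log 4 + log (1 + 2 * L) + |log (c / 2)|)) with hK₁
  have hK₁0 : 0 ≤ K₁ := by
    have h1 := log_nonneg hL
    have h2 : 0 ≤ log 2 := log_nonneg (by norm_num)
    have h3 : 0 ≤ log 4 := log_nonneg (by norm_num)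
    have h4 : 0 ≤ log (1 + 2 * L) := log_nonneg (by linarith)
    have h5 := abs_nonneg (log (c / 2))
    linarith
  refine ⟨(32 * L + 2 * K₁) * (2 + 2 * K), r₀, by positivity, fun r S hr hS w hw => ?_⟩
  have hr1 : 1 ≤ r := by linarith
  have hr0 : 0 < r := by linarith
  have hS4 : 4 * r ≤ S := by
    have : 1 ≤ L ^ 2 := one_le_pow₀ hL
    nlinarith
  have hS0 : 0 < S := by linarith
  -- The geometric mean balances both error terms: log(S/R) = log(S/r)/2 controls the zeros and
  -- poles, and r/R ≤ 2/log(S/r) controls the harmonic part. The hypothesis 4L²r ≤ S is exactly 2Lr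
  -- ≤ R.
  set R := √(r * S) with hR
  have hR2 : R ^ 2 = r * S := sq_sqrt (by positivity)
  have hRpos : 0 < R := sqrt_pos.2 (by positivity)
  have hRS : R ≤ S := by
    rw [hR, sqrt_le_left hS0.le]
    nlinarith
  have h2L : 2 * L * r ≤ R := by
    refine (le_sqrt' (by positivity)).2 ?_
    nlinarith
  have hR1 : 1 ≤ R := by nlinarith
  have hlogR : 2 * log R = log r + log S := by
    rw [← log_mul hr0.ne' hS0.ne', ← hR2, log_pow]
    norm_num
  set ℓ := log (S / r) with hℓ
  have hℓe : ℓ = log S - log r := log_div hS0.ne' hr0.ne'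
  have hℓ0 : 0 < ℓ := log_pos (by rw [lt_div_iff₀ hr0]; linarith)
  have hmono : ∀ g : ℂ → ℂ, Meromorphic g → characteristic g ⊤ R ≤ characteristic g ⊤ S :=
    fun g hg => characteristic_monotoneOn hg hRpos hS0 hRS
  set Q := characteristic f ⊤ S + characteristic f⁻¹ ⊤ S with hQ
  have hP : proximity f ⊤ R + proximity f⁻¹ ⊤ R ≤ Q := by
    have h1 := hmono f hf.1
    have h2 := hmono f⁻¹ hf.1.inv
    have h3 : 0 ≤ logCounting f ⊤ R := logCounting_nonneg hR1
    have h4 : 0 ≤ logCounting f⁻¹ ⊤ R := logCounting_nonneg hR1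
    have h5 : characteristic f ⊤ R = proximity f ⊤ R + logCounting f ⊤ R := rfl
    have h6 : characteristic f⁻¹ ⊤ R = proximity f⁻¹ ⊤ R + logCounting f⁻¹ ⊤ R := rfl
    linarith
  have hn : zeroPoleCount f R * ℓ ≤ 2 * Q := by
    have h1 := zeroPoleCount_mul_log_le hf.1 hR1 hRS
    have h2 : 0 ≤ proximity f ⊤ S := proximity_nonneg S
    have h3 : 0 ≤ proximity f⁻¹ ⊤ S := proximity_nonneg S
    have h5 : characteristic f ⊤ S = proximity f ⊤ S + logCounting f ⊤ S := rfl
    have h6 : characteristic f⁻¹ ⊤ S = proximity f⁻¹ ⊤ S + logCounting f 0 S := by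
      rw [← logCounting_inv]
      rfl
    have h7 : log S - log R = ℓ / 2 := by linarith
    rw [h7] at h1
    linarith
  have hrR : r / R * ℓ ≤ 2 := by
    have h1 : log (R / r) ≤ R / r := by
      have := log_le_sub_one_of_pos (div_pos hRpos hr0)
      linarith
    have h2 : ℓ = 2 * log (R / r) := by
      rw [log_div hRpos.ne' hr0.ne']
      linarith
    have h3 : r / R * (R / r) = 1 := by field_simp
    rw [h2]
    nlinarith [div_pos hr0 hRpos]
  have hQ0 : 0 ≤ Q := add_nonneg (characteristic_nonneg (by linarith))
    (characteristic_nonneg (by linarith))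
  have hQT : Q ≤ (2 + 2 * K) * characteristic f ⊤ S := by
    have h1 := hK S
    have h2 := (hlow S (by linarith)).2
    nlinarith
  refine (circleAverage_abs_log_shift_le hf.1 (order_ne_top hf) hc hL hr1 h2L hw).trans ?_
  rw [← mul_div_assoc ((32 * L + 2 * K₁) * (2 + 2 * K)), le_div_iff₀ hℓ0, add_mul]
  have e1 : 16 * L * (r / R) * (proximity f ⊤ R + proximity f⁻¹ ⊤ R) * ℓ ≤ 32 * L * Q := by
    have : 16 * L * (r / R) * (proximity f ⊤ R + proximity f⁻¹ ⊤ R) * ℓ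
        = 16 * L * (r / R * ℓ) * (proximity f ⊤ R + proximity f⁻¹ ⊤ R) := by ring
    rw [this]
    calc 16 * L * (r / R * ℓ) * (proximity f ⊤ R + proximity f⁻¹ ⊤ R)
        ≤ 16 * L * (r / R * ℓ) * Q := mul_le_mul_of_nonneg_left hP (by positivity)
      _ ≤ 16 * L * 2 * Q := by gcongr
      _ = 32 * L * Q := by ring
  have e2 : K₁ * zeroPoleCount f R * ℓ ≤ 2 * K₁ * Q := by nlinarith
  calc _ ≤ 32 * L * Q + 2 * K₁ * Q := add_le_add e1 e2
    _ = (32 * L + 2 * K₁) * Q := by ring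
    _ ≤ (32 * L + 2 * K₁) * ((2 + 2 * K) * characteristic f ⊤ S) :=
        mul_le_mul_of_nonneg_left hQT (by positivity)
    _ = _ := by ring

end AskeyWilsonGrowth


/-! ### The outer branch of z, the shifts, and the operator near infinity -/

namespace AskeyWilsonGrowth

open Real Metric Function Topology

/-- The solution `z` of `x = (z + 1/z) / 2` outside the unit disk, for `1 < ‖x‖`. -/
noncomputable def outerPoint (x : ℂ) : ℂ := x * (1 + (1 - (x ^ 2)⁻¹) ^ (1 / 2 : ℂ))

/-- The point `(c z + 1/(c z)) / 2` where `x = (z + 1/z) / 2` and `z` is outside the unit disk. -/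
noncomputable def shift (c x : ℂ) : ℂ := (c * outerPoint x + (c * outerPoint x)⁻¹) / 2

theorem sq_cpow_half (w : ℂ) : (w ^ (1 / 2 : ℂ)) ^ 2 = w := by
  rw [one_div]
  exact Complex.cpow_nat_inv_pow w two_ne_zero

theorem re_cpow_half_nonneg (w : ℂ) : 0 ≤ (w ^ (1 / 2 : ℂ)).re := by
  rcases eq_or_ne w 0 with rfl | hw
  · simp
  rw [Complex.cpow_def_of_ne_zero hw, Complex.exp_re]
  refine mul_nonneg (exp_pos _).le (cos_nonneg_of_mem_Icc ?_)
  have e : (Complex.log w * (1 / 2)).im = w.arg / 2 := by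
    rw [show (1 / 2 : ℂ) = ((1 / 2 : ℝ) : ℂ) by norm_num, Complex.im_mul_ofReal, Complex.log_im]
    ring
  rw [e]
  have := Complex.neg_pi_lt_arg w
  have := Complex.arg_le_pi w
  constructor <;> linarith

theorem norm_inv_sq_lt_one {x : ℂ} (hx : 1 < ‖x‖) : ‖(x ^ 2)⁻¹‖ < 1 := by
  rw [norm_inv, norm_pow]
  exact inv_lt_one_of_one_lt₀ (one_lt_pow₀ hx two_ne_zero)

theorem outerPoint_mul {x : ℂ} (hx : 1 < ‖x‖) :
    outerPoint x * (x * (1 - (1 - (x ^ 2)⁻¹) ^ (1 / 2 : ℂ))) = 1 := by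
  have h0 : x ≠ 0 := norm_pos_iff.1 (by linarith)
  have h := sq_cpow_half (1 - (x ^ 2)⁻¹)
  have h2 : x ^ 2 * (x ^ 2)⁻¹ = 1 := mul_inv_cancel₀ (pow_ne_zero 2 h0)
  unfold outerPoint
  linear_combination -x ^ 2 * h + h2

theorem outerPoint_spec {x : ℂ} (hx : 1 < ‖x‖) : (outerPoint x + (outerPoint x)⁻¹) / 2 = x := by
  rw [inv_eq_of_mul_eq_one_right (outerPoint_mul hx), outerPoint]
  ring

/-- The principal square root has non-negative real part, so the factor multiplying x has real part
at least 1. -/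
theorem norm_le_norm_outerPoint (x : ℂ) : ‖x‖ ≤ ‖outerPoint x‖ := by
  rw [outerPoint, norm_mul]
  refine le_mul_of_one_le_right (norm_nonneg _) ?_
  refine le_trans ?_ (Complex.re_le_norm _)
  have := re_cpow_half_nonneg (1 - (x ^ 2)⁻¹)
  simpa using this

theorem norm_outerPoint_le {x : ℂ} (hx : 1 < ‖x‖) : ‖outerPoint x‖ ≤ 3 * ‖x‖ := by
  have h1 : ‖(1 - (x ^ 2)⁻¹) ^ (1 / 2 : ℂ)‖ ^ 2 ≤ 2 := by
    rw [← norm_pow, sq_cpow_half]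
    refine (norm_sub_le _ _).trans ?_
    rw [norm_one]
    linarith [norm_inv_sq_lt_one hx]
  have h2 : ‖1 + (1 - (x ^ 2)⁻¹) ^ (1 / 2 : ℂ)‖ ≤ 3 := by
    refine (norm_add_le _ _).trans ?_
    rw [norm_one]
    nlinarith [norm_nonneg ((1 - (x ^ 2)⁻¹) ^ (1 / 2 : ℂ))]
  rw [outerPoint, norm_mul, mul_comm]
  exact mul_le_mul_of_nonneg_right h2 (norm_nonneg _)

/-- Factoring x out of the root places its argument 1 - x⁻² in the right half-plane, away from the
branch cut. -/
theorem analyticAt_outerPoint {x : ℂ} (hx : 1 < ‖x‖) : AnalyticAt ℂ outerPoint x := by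
  have h0 : x ≠ 0 := norm_pos_iff.1 (by linarith)
  have hs : 1 - (x ^ 2)⁻¹ ∈ Complex.slitPlane := by
    left
    have h1 := (Complex.re_le_norm (x ^ 2)⁻¹).trans_lt (norm_inv_sq_lt_one hx)
    simpa using h1
  have ha : AnalyticAt ℂ (fun x : ℂ => 1 - (x ^ 2)⁻¹) x :=
    analyticAt_const.sub ((analyticAt_id.pow 2).inv (pow_ne_zero 2 h0))
  exact analyticAt_id.mul (analyticAt_const.add (ha.cpow analyticAt_const hs))

theorem outerPoint_ne_zero {x : ℂ} (hx : 1 < ‖x‖) : outerPoint x ≠ 0 := fun h => by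
  simpa [h] using outerPoint_mul hx

theorem analyticAt_shift {c x : ℂ} (hc : c ≠ 0) (hx : 1 < ‖x‖) : AnalyticAt ℂ (shift c) x := by
  have h := (analyticAt_const (v := c)).mul (analyticAt_outerPoint hx)
  exact (h.add (h.inv (mul_ne_zero hc (outerPoint_ne_zero hx)))).div_const

theorem norm_shift_le {c x : ℂ} (hc : c ≠ 0) (hx : 1 < ‖x‖) :
    ‖shift c x‖ ≤ (3 * ‖c‖ + ‖c‖⁻¹) * ‖x‖ := by
  have h1 := norm_outerPoint_le hx
  have h2 := norm_le_norm_outerPoint x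
  have hc0 : 0 < ‖c‖ := norm_pos_iff.2 hc
  have h3 : ‖outerPoint x‖⁻¹ ≤ ‖x‖ :=
    (inv_le_one_of_one_le₀ (by linarith)).trans hx.le
  rw [shift, norm_div, Complex.norm_ofNat]
  have h4 : ‖c * outerPoint x + (c * outerPoint x)⁻¹‖ ≤ (3 * ‖c‖ + ‖c‖⁻¹) * ‖x‖ := by
    refine (norm_add_le _ _).trans ?_
    rw [norm_inv, norm_mul, mul_inv, add_mul]
    refine add_le_add ?_ ?_
    · calc ‖c‖ * ‖outerPoint x‖ ≤ ‖c‖ * (3 * ‖x‖) := by gcongr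
        _ = 3 * ‖c‖ * ‖x‖ := by ring
    · gcongr
  have h5 := norm_nonneg (c * outerPoint x + (c * outerPoint x)⁻¹)
  linarith

/-- With z, z' the outer points and P = zz', the two differences are (z - z')/2 times c - 1/(cP) and
times 1 - 1/P. The threshold on the moduli makes |P| ≥ 4/|c|², so the first factor is at least |c|/2
and the second at most 2. -/
theorem le_norm_shift_sub {c x y : ℂ} (hc : c ≠ 0) (hx : 1 + 2 * ‖c‖⁻¹ ≤ ‖x‖)
    (hy : 1 + 2 * ‖c‖⁻¹ ≤ ‖y‖) : ‖c‖ / 4 * ‖x - y‖ ≤ ‖shift c x - shift c y‖ := by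
  have hc0 : 0 < ‖c‖ := norm_pos_iff.2 hc
  have hi : 0 < ‖c‖⁻¹ := inv_pos.2 hc0
  have hx1 : 1 < ‖x‖ := by linarith
  have hy1 : 1 < ‖y‖ := by linarith
  have hxo := norm_le_norm_outerPoint x
  have hyo := norm_le_norm_outerPoint y
  have hx0 := outerPoint_ne_zero hx1
  have hy0 := outerPoint_ne_zero hy1
  have e1 : shift c x - shift c y
      = (outerPoint x - outerPoint y) / 2 * (c - c⁻¹ * (outerPoint x * outerPoint y)⁻¹) := by
    unfold shift
    field_simp
    ring
  have e2 : x - y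
      = (outerPoint x - outerPoint y) / 2 * (1 - (outerPoint x * outerPoint y)⁻¹) := by
    conv_lhs => rw [← outerPoint_spec hx1, ← outerPoint_spec hy1]
    field_simp
    ring
  have hP : 4 * ‖c‖⁻¹ * ‖c‖⁻¹ ≤ ‖outerPoint x * outerPoint y‖ ∧
      1 ≤ ‖outerPoint x * outerPoint y‖ := by
    rw [norm_mul]
    constructor <;> nlinarith
  set P := outerPoint x * outerPoint y
  have hP0 : 0 < ‖P‖ := by linarith
  have h1 : ‖1 - P⁻¹‖ ≤ 2 := by
    refine (norm_sub_le _ _).trans ?_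
    rw [norm_one, norm_inv]
    linarith [inv_le_one_of_one_le₀ hP.2]
  have h2 : ‖c‖ / 2 ≤ ‖c - c⁻¹ * P⁻¹‖ := by
    have h3 : ‖c⁻¹ * P⁻¹‖ ≤ ‖c‖ / 2 := by
      rw [norm_mul, norm_inv, norm_inv, ← div_eq_mul_inv, div_le_iff₀ hP0]
      have h4 : ‖c‖ * ‖c‖⁻¹ = 1 := mul_inv_cancel₀ hc0.ne'
      nlinarith
    have := norm_sub_norm_le c (c⁻¹ * P⁻¹)
    linarith
  rw [e1, e2, norm_mul, norm_mul]
  have h5 := norm_nonneg ((outerPoint x - outerPoint y) / 2)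
  calc ‖c‖ / 4 * (‖(outerPoint x - outerPoint y) / 2‖ * ‖1 - P⁻¹‖)
      ≤ ‖c‖ / 4 * (‖(outerPoint x - outerPoint y) / 2‖ * 2) := by gcongr
    _ = ‖(outerPoint x - outerPoint y) / 2‖ * (‖c‖ / 2) := by ring
    _ ≤ _ := by gcongr

/-- Expansion at rate |c|/4 excludes the difference quotients below |c|/8 that a zero derivative
would produce. -/
theorem deriv_shift_ne_zero {c x : ℂ} (hc : c ≠ 0) (hx : 1 + 2 * ‖c‖⁻¹ < ‖x‖) :
    deriv (shift c) x ≠ 0 := fun h => by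
  have hc0 : 0 < ‖c‖ := norm_pos_iff.2 hc
  have hi : 0 < ‖c‖⁻¹ := inv_pos.2 hc0
  have hd := (analyticAt_shift hc (x := x) (by linarith)).differentiableAt.hasDerivAt
  rw [h, hasDerivAt_iff_isLittleO] at hd
  have h1 := hd.def (c := ‖c‖ / 8) (by positivity)
  have h2 : ∀ᶠ y : ℂ in 𝓝 x, 1 + 2 * ‖c‖⁻¹ < ‖y‖ :=
    continuous_norm.continuousAt.eventually_const_lt hx
  have h3 : ∀ᶠ y : ℂ in 𝓝[≠] x, False := by
    filter_upwards [h1.filter_mono nhdsWithin_le_nhds, h2.filter_mono nhdsWithin_le_nhds,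
      self_mem_nhdsWithin] with y hy1 hy2 hy3
    have h4 := le_norm_shift_sub hc hy2.le hx.le
    simp only [smul_zero, sub_zero] at hy1
    have h5 : 0 < ‖y - x‖ := norm_pos_iff.2 (sub_ne_zero.2 hy3)
    nlinarith
  exact h3.exists.elim fun _ h => h

theorem isCircleShift_shift {c : ℂ} (hc : c ≠ 0) {r δ L : ℝ} (hr : 1 + 2 * ‖c‖⁻¹ < r)
    (hδ : δ ≤ ‖c‖ / 4) (hL : 3 * ‖c‖ + ‖c‖⁻¹ ≤ L) : IsCircleShift δ L r (shift c) := by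
  have hi : 0 < ‖c‖⁻¹ := inv_pos.2 (norm_pos_iff.2 hc)
  refine ⟨fun x hx => ?_, fun x hx => ?_, fun x hx => ?_, fun x hx y hy => ?_⟩ <;>
    rw [mem_sphere_zero_iff_norm] at hx
  · exact analyticAt_shift hc (by linarith)
  · exact deriv_shift_ne_zero hc (by linarith)
  · refine (norm_shift_le hc (by linarith)).trans ?_
    rw [hx]
    gcongr
    linarith
  · rw [mem_sphere_zero_iff_norm] at hy
    exact (mul_le_mul_of_nonneg_right hδ (norm_nonneg _)).trans
      (le_norm_shift_sub hc (by linarith) (by linarith))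

/-! ### Iterates of the Askey-Wilson operator -/

theorem breve_id_sub (p z : ℂ) :
    breve id (p * z) - breve id (p⁻¹ * z) = (p - p⁻¹) * (z - z⁻¹) / 2 := by
  simp only [breve, id, mul_inv, inv_inv]
  ring

theorem norm_le_norm_breve_id_sub {p z : ℂ} (hz : 2 ≤ ‖z‖) :
    ‖p - p⁻¹‖ / 2 ≤ ‖breve id (p * z) - breve id (p⁻¹ * z)‖ := by
  have h1 : 1 ≤ ‖z - z⁻¹‖ := by
    have := norm_sub_norm_le z z⁻¹
    rw [norm_inv] at this
    have := inv_le_one_of_one_le₀ (by linarith : 1 ≤ ‖z‖)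
    linarith
  rw [breve_id_sub, norm_div, norm_mul, Complex.norm_ofNat]
  have := norm_nonneg (p - p⁻¹)
  nlinarith

theorem askeyWilson_of_two_le_norm (p : ℂ) (f : ℂ → ℂ) {z : ℂ} (hz : 2 ≤ ‖z‖) :
    askeyWilson p f ((z + z⁻¹) / 2) =
      (breve f (p * z) - breve f (p⁻¹ * z)) / (breve id (p * z) - breve id (p⁻¹ * z)) := by
  have h0 : z ≠ 0 := norm_pos_iff.1 (by linarith)
  refine askeyWilson_eq p f h0 rfl ?_ ?_ <;> intro h
  · have : (z - 1) ^ 2 = 0 := by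
      field_simp at h
      linear_combination h
    have : z = 1 := by simpa [sub_eq_zero] using this
    rw [this, norm_one] at hz
    norm_num at hz
  · have : (z + 1) ^ 2 = 0 := by
      field_simp at h
      linear_combination h
    have : z = -1 := by simpa [add_eq_zero_iff_eq_neg] using this
    rw [this, norm_neg, norm_one] at hz
    norm_num at hz

/-- Each application doubles the terms, replacing z by pz and by z/p, and divides by a quantity
bounded below for |z| ≥ 2. Multiplying the threshold `X` by 1/|p| keeps pz in the region of the
previous step. -/
theorem exists_iterate_askeyWilson_breve {p : ℂ} (hp0 : p ≠ 0) (hp1 : ‖p‖ < 1) (j : ℕ) :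
    ∃ (ι : Type) (_ : Fintype ι) (c : ι → ℂ) (b : ι → ℂ → ℂ) (X B : ℝ),
      2 ≤ X ∧ (∀ i, c i ≠ 0) ∧ (∀ i z, X < ‖z‖ → AnalyticAt ℂ (b i) z ∧ ‖b i z‖ ≤ B) ∧
      ∀ (f : ℂ → ℂ) (z : ℂ), X < ‖z‖ →
        (askeyWilson p)^[j] f ((z + z⁻¹) / 2) = ∑ i, b i z * breve f (c i * z) := by
  have hpp : 0 < ‖p‖ := norm_pos_iff.2 hp0
  have hi1 : 1 < ‖p‖⁻¹ := (one_lt_inv₀ hpp).2 hp1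
  have hpi : 0 < ‖p - p⁻¹‖ := by
    have := norm_sub_norm_le p⁻¹ p
    rw [norm_inv, norm_sub_rev] at this
    linarith
  induction j with
  | zero =>
    refine ⟨Unit, inferInstance, fun _ => 1, fun _ _ => 1, 2, 1, le_rfl, by simp,
      fun _ _ _ => ⟨analyticAt_const, by simp⟩, fun f z _ => by simp [breve]⟩
  | succ j ih =>
    obtain ⟨ι, _, c, b, X, B, hX, hc, hb, hD⟩ := ih
    have hB' : ∀ (t z : ℂ) i, X < ‖t * z‖ → 2 ≤ ‖z‖ →
        ‖b i (t * z) / (breve id (p * z) - breve id (p⁻¹ * z))‖ ≤ B / (‖p - p⁻¹‖ / 2) := by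
      intro t z i htz hz
      have h1 := (hb i _ htz).2
      have h2 := norm_le_norm_breve_id_sub (p := p) hz
      rw [norm_div]
      have := (norm_nonneg _).trans h1
      gcongr
    have hA' : ∀ (t z : ℂ) i, X < ‖t * z‖ → 2 ≤ ‖z‖ →
        AnalyticAt ℂ (fun z => b i (t * z) / (breve id (p * z) - breve id (p⁻¹ * z))) z := by
      intro t z i htz hz
      have h0 : z ≠ 0 := norm_pos_iff.1 (by linarith)
      refine AnalyticAt.fun_div
        ((hb i _ htz).1.comp (f := fun z => t * z) (analyticAt_const.mul analyticAt_id)) ?_ ?_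
      · simp only [breve_id_sub]
        have := analyticAt_inv (𝕜 := ℂ) h0
        fun_prop
      · have h2 := norm_le_norm_breve_id_sub (p := p) hz
        exact norm_pos_iff.1 (by linarith)
    have hz : ∀ z : ℂ, X * ‖p‖⁻¹ < ‖z‖ → 2 ≤ ‖z‖ ∧ X < ‖p * z‖ ∧ X < ‖p⁻¹ * z‖ := by
      intro z hz
      have h1 : X < ‖p‖ * ‖z‖ := by
        rwa [← div_eq_mul_inv, div_lt_iff₀' hpp] at hz
      have h2 : X < ‖z‖ := by nlinarith
      rw [norm_mul, norm_mul, norm_inv]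
      refine ⟨by linarith, h1, by nlinarith⟩
    refine ⟨ι ⊕ ι, inferInstance, Sum.elim (fun i => c i * p) (fun i => c i * p⁻¹),
      Sum.elim (fun i z => b i (p * z) / (breve id (p * z) - breve id (p⁻¹ * z)))
        (fun i z => -(b i (p⁻¹ * z) / (breve id (p * z) - breve id (p⁻¹ * z)))),
      X * ‖p‖⁻¹, B / (‖p - p⁻¹‖ / 2), by nlinarith, ?_, ?_, ?_⟩
    · rintro (i | i)
      · exact mul_ne_zero (hc i) hp0
      · exact mul_ne_zero (hc i) (inv_ne_zero hp0)
    · rintro (i | i) z hzX <;> obtain ⟨h2, h3, h4⟩ := hz z hzX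
      · exact ⟨hA' p z i h3 h2, hB' p z i h3 h2⟩
      · refine ⟨(hA' p⁻¹ z i h4 h2).neg, ?_⟩
        rw [Sum.elim_inr, norm_neg]
        exact hB' p⁻¹ z i h4 h2
    · intro f z hzX
      obtain ⟨h2, h3, h4⟩ := hz z hzX
      rw [iterate_succ', comp_apply, askeyWilson_of_two_le_norm p _ h2]
      have e1 := hD f (p * z) h3
      have e2 := hD f (p⁻¹ * z) h4
      rw [breve, breve, e1, e2, Fintype.sum_sum_type, sub_div, Finset.sum_div, Finset.sum_div,
        sub_eq_add_neg, ← Finset.sum_neg_distrib]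
      simp only [Sum.elim_inl, Sum.elim_inr, mul_assoc]
      congr 1 <;> exact Finset.sum_congr rfl fun i _ => by ring

theorem exists_iterate_askeyWilson_shift {p : ℂ} (hp0 : p ≠ 0) (hp1 : ‖p‖ < 1) (j : ℕ) :
    ∃ (ι : Type) (_ : Fintype ι) (c : ι → ℂ) (b : ι → ℂ → ℂ) (X B : ℝ),
      2 ≤ X ∧ (∀ i, c i ≠ 0) ∧ (∀ i x, X < ‖x‖ → AnalyticAt ℂ (b i) x ∧ ‖b i x‖ ≤ B) ∧
      ∀ (f : ℂ → ℂ) (x : ℂ), X < ‖x‖ →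
        (askeyWilson p)^[j] f x = ∑ i, b i x * f (shift (c i) x) := by
  obtain ⟨ι, inst, c, b, X, B, hX, hc, hb, hD⟩ := exists_iterate_askeyWilson_breve hp0 hp1 j
  have h1 : ∀ x : ℂ, X < ‖x‖ → X < ‖outerPoint x‖ := fun x hx =>
    hx.trans_le (norm_le_norm_outerPoint x)
  refine ⟨ι, inst, c, fun i x => b i (outerPoint x), X, B, hX, hc, fun i x hx => ⟨?_, ?_⟩,
    fun f x hx => ?_⟩
  · exact (hb i _ (h1 x hx)).1.comp (analyticAt_outerPoint (by linarith))
  · exact (hb i _ (h1 x hx)).2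
  · have := hD f (outerPoint x) (h1 x hx)
    rwa [outerPoint_spec (by linarith)] at this

/-- The double sum over j and shifts is flattened, `k` recording the coefficient. The term j = 0
stays apart, since it carries the dominant coefficient. -/
theorem exists_askeyWilson_sum_shift {p : ℂ} (hp0 : p ≠ 0) (hp1 : ‖p‖ < 1) (n : ℕ) :
    ∃ (ι : Type) (_ : Fintype ι) (k : ι → ℕ) (c : ι → ℂ) (b : ι → ℂ → ℂ) (X B : ℝ),
      2 ≤ X ∧ (∀ i, 1 ≤ k i ∧ k i ≤ n) ∧ (∀ i, c i ≠ 0) ∧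
      (∀ i x, X < ‖x‖ → AnalyticAt ℂ (b i) x ∧ ‖b i x‖ ≤ B) ∧
      ∀ (a : ℕ → ℂ → ℂ) (f : ℂ → ℂ) (x : ℂ), X < ‖x‖ →
        ∑ j ∈ Finset.range (n + 1), a j x * (askeyWilson p)^[j] f x =
          a 0 x * f x + ∑ i, a (k i) x * (b i x * f (shift (c i) x)) := by
  induction n with
  | zero =>
    exact ⟨Empty, inferInstance, Empty.elim, Empty.elim, Empty.elim, 2, 1, le_rfl,
      fun i => i.elim, fun i => i.elim, fun i => i.elim, fun a f x _ => by simp⟩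
  | succ n ih =>
    obtain ⟨ι, _, k, c, b, X, B, hX, hk, hc, hb, hD⟩ := ih
    obtain ⟨ι', _, c', b', X', B', hX', hc', hb', hD'⟩ :=
      exists_iterate_askeyWilson_shift hp0 hp1 (n + 1)
    refine ⟨ι ⊕ ι', inferInstance, Sum.elim k fun _ => n + 1, Sum.elim c c', Sum.elim b b',
      max X X', max B B', hX.trans (le_max_left _ _), ?_, ?_, ?_, ?_⟩
    · rintro (i | i)
      · exact ⟨(hk i).1, (hk i).2.trans n.le_succ⟩
      · simp
    · rintro (i | i)
      exacts [hc i, hc' i]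
    · rintro (i | i) x hx
      · have h := hb i x ((le_max_left _ _).trans_lt hx)
        exact ⟨h.1, h.2.trans (le_max_left _ _)⟩
      · have h := hb' i x ((le_max_right _ _).trans_lt hx)
        exact ⟨h.1, h.2.trans (le_max_right _ _)⟩
    · intro a f x hx
      rw [Finset.sum_range_succ, hD a f x ((le_max_left _ _).trans_lt hx),
        hD' f x ((le_max_right _ _).trans_lt hx), Fintype.sum_sum_type, Finset.mul_sum, add_assoc]
      rfl

end AskeyWilsonGrowth


/-! ### The equation near infinity: proximity and counting functions -/

namespace AskeyWilsonGrowth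

open Real Metric Function Topology ValueDistribution MeromorphicOn

/-- The relation `g f = -∑ i, A i * b i * (f ∘ shift (c i))` in a neighbourhood of infinity, with
bounded analytic weights `b i`. -/
structure ShiftRelation {ι : Type} [Fintype ι] (g : ℂ → ℂ) (A : ι → ℂ → ℂ) (f : ℂ → ℂ) (c : ι → ℂ)
    (b : ι → ℂ → ℂ) (X B L : ℝ) : Prop where
  one_le : 1 ≤ L
  ne_zero : ∀ i, c i ≠ 0
  norm_add_inv_le : ∀ i, 3 * ‖c i‖ + ‖c i‖⁻¹ ≤ L
  le_radius : 1 + 2 * L ≤ X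
  analyticAt : ∀ i x, X < ‖x‖ → AnalyticAt ℂ (b i) x
  norm_le : ∀ i x, X < ‖x‖ → ‖b i x‖ ≤ B
  eq_neg_sum : ∀ᶠ x in codiscrete ℂ, X < ‖x‖ →
    g x * f x = -∑ i, A i x * (b i x * f (shift (c i) x))

namespace ShiftRelation

variable {ι : Type} [Fintype ι] {g : ℂ → ℂ} {A : ι → ℂ → ℂ} {f : ℂ → ℂ} {c : ι → ℂ}
  {b : ι → ℂ → ℂ} {X B L : ℝ}

theorem inv_norm_le (h : ShiftRelation g A f c b X B L) (i : ι) : ‖c i‖⁻¹ ≤ L := by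
  have := h.norm_add_inv_le i
  have := norm_nonneg (c i)
  linarith

theorem isCircleShift (h : ShiftRelation g A f c b X B L) (i : ι) {r : ℝ} (hr : X < r) :
    IsCircleShift (1 / (4 * L)) L r (shift (c i)) := by
  have hL := h.one_le
  have hi := h.inv_norm_le i
  refine isCircleShift_shift (h.ne_zero i) (by linarith [h.le_radius]) ?_ (h.norm_add_inv_le i)
  have h1 : L⁻¹ ≤ ‖c i‖ := inv_le_of_inv_le₀ (norm_pos_iff.2 (h.ne_zero i)) hi
  have h2 : 1 / (4 * L) = L⁻¹ / 4 := by field_simp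
  rw [h2]
  linarith

/-- Divide the relation by f(x) and use that log⁺ is subadditive on products and, up to the
logarithm of the number of terms, on sums. -/
theorem posLog_le (x : ℂ) {s : ι → ℂ} (hB : ∀ i, ‖b i x‖ ≤ B) (hfx : f x ≠ 0)
    (hx : g x * f x = -∑ i, A i x * (b i x * f (s i))) :
    log⁺ ‖g x‖ ≤ (log (Fintype.card ι) + Fintype.card ι * log⁺ B) +
      (∑ i, log⁺ ‖A i x‖ + ∑ i, |log ‖f (s i)‖ - log ‖f x‖|) := by
  have e : g x = -∑ i, A i x * (b i x * (f (s i) / f x)) := by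
    have : ∑ i, A i x * (b i x * (f (s i) / f x)) = (∑ i, A i x * (b i x * f (s i))) / f x := by
      rw [Finset.sum_div]
      exact Finset.sum_congr rfl fun i _ => by ring
    rw [this, ← neg_div, ← hx, mul_div_cancel_right₀ _ hfx]
  have hq : ∀ i, log⁺ ‖f (s i) / f x‖ ≤ |log ‖f (s i)‖ - log ‖f x‖| := fun i => by
    rcases eq_or_ne (f (s i)) 0 with h0 | h0
    · rw [h0, zero_div, norm_zero, posLog_zero]
      exact abs_nonneg _
    · rw [norm_div, ← log_div (norm_ne_zero_iff.2 h0) (norm_ne_zero_iff.2 hfx),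
        abs_log_eq_posLog_add_posLog_inv]
      exact le_add_of_nonneg_right posLog_nonneg
  have hterm : ∀ i, log⁺ ‖A i x * (b i x * (f (s i) / f x))‖ ≤
      log⁺ ‖A i x‖ + (log⁺ B + |log ‖f (s i)‖ - log ‖f x‖|) := fun i => by
    rw [norm_mul, norm_mul]
    refine posLog_mul.trans (add_le_add le_rfl (posLog_mul.trans (add_le_add ?_ (hq i))))
    exact posLog_le_posLog (norm_nonneg _) (hB i)
  rw [e, norm_neg]
  refine (posLog_norm_sum_le _ _).trans ?_
  refine (add_le_add le_rfl (Finset.sum_le_sum fun i _ => hterm i)).trans_eq ?_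
  simp only [Finset.sum_add_distrib, Finset.sum_const, Finset.card_univ, nsmul_eq_mul]
  ring

theorem exists_proximity_le (h : ShiftRelation g A f c b X B L) (hf : IsNonconstantMeromorphic f)
    (hg : Meromorphic g) (hA : ∀ i, Meromorphic (A i)) :
    ∃ C r₀ Λ : ℝ, 0 ≤ C ∧ 4 ≤ Λ ∧ ∀ r S : ℝ, r₀ ≤ r → Λ * r ≤ S →
      proximity g ⊤ r ≤ ∑ i, proximity (A i) ⊤ r + C * (characteristic f ⊤ S / log (S / r)) := by
  have hL := h.one_le
  obtain ⟨C, r₁, hC, hshift⟩ := exists_circleAverage_abs_log_shift_le hf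
    (c := 1 / (4 * L)) (L := L) (by positivity) hL
  obtain ⟨r₂, hr₂, hlow⟩ := eventually_log_le_two_mul_characteristic hf
  set M := log (Fintype.card ι) + Fintype.card ι * log⁺ B with hM
  have hM0 : 0 ≤ M := add_nonneg (log_natCast_nonneg _)
    (mul_nonneg (Nat.cast_nonneg _) posLog_nonneg)
  refine ⟨2 * M + Fintype.card ι * C, max (X + 1) (max r₁ r₂), 4 * L ^ 2, by positivity,
    by nlinarith, fun r S hr hS => ?_⟩
  have hrX : X < r := by linarith [(le_max_left _ _).trans hr]
  have hr1 : r₁ ≤ r := ((le_max_left _ _).trans (le_max_right _ _)).trans hr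
  have hr2 : r₂ ≤ r := ((le_max_right _ _).trans (le_max_right _ _)).trans hr
  have hr0 : 0 < r := by linarith
  have hrS : 4 * r ≤ S := by
    have : 1 ≤ L ^ 2 := one_le_pow₀ hL
    nlinarith
  have i0 : CircleIntegrable (fun x => log⁺ ‖g x‖) 0 r :=
    hg.meromorphicOn.circleIntegrable_posLog_norm
  have i1 : ∀ i ∈ Finset.univ, CircleIntegrable (fun x => log⁺ ‖A i x‖) 0 r := fun i _ =>
    (hA i).meromorphicOn.circleIntegrable_posLog_norm
  have i2 : ∀ i ∈ Finset.univ,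
      CircleIntegrable (fun x => |log ‖f (shift (c i) x)‖ - log ‖f x‖|) 0 r := fun i _ => by
    refine CircleIntegrable.abs (CircleIntegrable.sub
      (MeromorphicOn.circleIntegrable_log_norm (f := fun x => f (shift (c i) x)) ?_)
      hf.1.meromorphicOn.circleIntegrable_log_norm)
    rw [abs_of_pos hr0]
    exact fun x hx => (hf.1 _).comp_analyticAt ((h.isCircleShift i hrX).analytic x hx)
  have i1s := CircleIntegrable.fun_sum _ i1
  have i2s := CircleIntegrable.fun_sum _ i2
  have key : proximity g ⊤ r ≤ circleAverage (fun x => M + (∑ i, log⁺ ‖A i x‖ +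
      ∑ i, |log ‖f (shift (c i) x)‖ - log ‖f x‖|)) 0 r := by
    rw [proximity_top]
    refine circleAverage_mono_codiscreteWithin hr0.ne' i0
      ((circleIntegrable_const _ _ _).add (i1s.add i2s)) ?_
    rw [abs_of_pos hr0]
    have hne := (hf.1.meromorphicOn (s := univ)).eventually_codiscreteWithin_apply_ne_zero
      fun x _ => order_ne_top hf x
    filter_upwards [h.eq_neg_sum.filter_mono (codiscreteWithin_mono (subset_univ _)),
      hne.filter_mono (codiscreteWithin_mono (subset_univ _)), self_mem_codiscreteWithin _]
      with x hx hfx hxr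
    rw [mem_sphere_zero_iff_norm] at hxr
    have hxX : X < ‖x‖ := hxr ▸ hrX
    exact posLog_le x (fun i => h.norm_le i x hxX) hfx (hx hxX)
  rw [circleAverage_fun_add (f₂ := fun x => ∑ i, log⁺ ‖A i x‖ +
      ∑ i, |log ‖f (shift (c i) x)‖ - log ‖f x‖|) (circleIntegrable_const _ _ _) (i1s.add i2s),
    circleAverage_const,
    circleAverage_fun_add i1s i2s, circleAverage_fun_sum i1, circleAverage_fun_sum i2] at key
  have hsum : ∑ i, circleAverage (fun x => |log ‖f (shift (c i) x)‖ - log ‖f x‖|) 0 r ≤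
      Fintype.card ι * (C * (characteristic f ⊤ S / log (S / r))) := by
    refine (Finset.sum_le_sum fun i _ => hshift r S hr1 hS _ (h.isCircleShift i hrX)).trans_eq ?_
    simp
  have hlogpos : 0 < log (S / r) := log_pos (by rw [lt_div_iff₀ hr0]; linarith)
  -- As T(S,f) ≥ (log S)/2 ≥ log(S/r)/2, the constant `M` can be absorbed; this is the source of `2
  -- * M` in the witness.
  have hone : 1 ≤ 2 * (characteristic f ⊤ S / log (S / r)) := by
    rw [← mul_div_assoc, le_div_iff₀ hlogpos, one_mul]
    refine le_trans ?_ (hlow S (by linarith)).1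
    rw [log_div (by linarith) hr0.ne']
    linarith [log_nonneg (by linarith : 1 ≤ r)]
  have hpr : ∀ i, circleAverage (fun x => log⁺ ‖A i x‖) 0 r = proximity (A i) ⊤ r := fun i => by
    rw [proximity_top]
  simp only [hpr] at key
  have : M ≤ 2 * M * (characteristic f ⊤ S / log (S / r)) := by nlinarith
  linarith

/-! ### Counting poles -/

theorem neg_negPart_divisor_le_order {u : ℂ → ℂ} (hu : Meromorphic u) (x : ℂ) :
    ((-((divisor u univ)⁻ x) : ℤ) : WithTop ℤ) ≤ meromorphicOrderAt u x := by
  rw [locallyFinsuppWithin.negPart_apply, divisor_apply hu.meromorphicOn (mem_univ x)]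
  cases hx : meromorphicOrderAt u x with
  | top => exact le_top
  | coe m =>
    rw [WithTop.untop₀_coe]
    exact_mod_cast neg_le.1 (neg_le_negPart m)

theorem le_order_sum {κ : Type*} {s : Finset κ} {F : κ → ℂ → ℂ} {x : ℂ} {m : WithTop ℤ}
    (hF : ∀ i ∈ s, MeromorphicAt (F i) x) (hm : ∀ i ∈ s, m ≤ meromorphicOrderAt (F i) x) :
    m ≤ meromorphicOrderAt (∑ i ∈ s, F i) x := by
  classical
  induction s using Finset.induction with
  | empty =>
    have : meromorphicOrderAt (∑ i ∈ (∅ : Finset κ), F i) x = ⊤ := by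
      rw [Finset.sum_empty, meromorphicOrderAt_eq_top_iff]
      simp
    rw [this]
    exact le_top
  | insert i s hi ih =>
    rw [Finset.sum_insert hi]
    refine le_trans (le_min (hm i (Finset.mem_insert_self i s)) (ih
      (fun j hj => hF j (Finset.mem_insert_of_mem hj))
      fun j hj => hm j (Finset.mem_insert_of_mem hj))) (meromorphicOrderAt_add
        (hF i (Finset.mem_insert_self i s)) (MeromorphicAt.sum fun j hj =>
          hF j (Finset.mem_insert_of_mem hj)))

/-- Compare orders in g f = -∑ A b (f ∘ shift): the weights have order at least 0, and composition
with a shift preserves orders because its derivative does not vanish. Dividing by f adds its zeros.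
-/
theorem negPart_divisor_le (h : ShiftRelation g A f c b X B L) (hf : IsNonconstantMeromorphic f)
    (hg : Meromorphic g) (hA : ∀ i, Meromorphic (A i)) {x : ℂ} (hx : X < ‖x‖) :
    (divisor g univ)⁻ x ≤ ∑ i, (divisor (A i) univ)⁻ x + (divisor f univ)⁺ x +
      ∑ i, (divisor f univ)⁻ (shift (c i) x) := by
  have hx1 : 1 < ‖x‖ := by linarith [h.one_le, h.le_radius]
  have hnn : ∀ (u : ℂ → ℂ) y, 0 ≤ (divisor u univ)⁻ y := fun u y => by
    rw [locallyFinsuppWithin.negPart_apply]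
    exact negPart_nonneg _
  set M := ∑ i, (divisor (A i) univ)⁻ x + ∑ i, (divisor f univ)⁻ (shift (c i) x) with hM
  have hsh : ∀ i, AnalyticAt ℂ (shift (c i)) x := fun i => analyticAt_shift (h.ne_zero i) hx1
  have hfs : ∀ i, MeromorphicAt (f ∘ shift (c i)) x := fun i => (hf.1 _).comp_analyticAt (hsh i)
  have hbm : ∀ i, MeromorphicAt (b i) x := fun i => (h.analyticAt i x hx).meromorphicAt
  have hev : g * f =ᶠ[𝓝[≠] x] -∑ i, A i * (b i * (f ∘ shift (c i))) := by
    have h1 : ∀ᶠ y : ℂ in 𝓝 x, X < ‖y‖ := continuous_norm.continuousAt.eventually_const_lt hx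
    have h2 := mem_codiscrete.1 h.eq_neg_sum x
    rw [disjoint_principal_right, compl_compl] at h2
    filter_upwards [h2, h1.filter_mono nhdsWithin_le_nhds] with y hy1 hy2
    simpa using hy1 hy2
  have horder : ((-M : ℤ) : WithTop ℤ) ≤ meromorphicOrderAt (g * f) x := by
    rw [meromorphicOrderAt_congr hev, ← meromorphicOrderAt_neg]
    refine le_order_sum (fun i _ => (hA i x).mul ((hbm i).mul (hfs i))) fun i _ => ?_
    rw [meromorphicOrderAt_mul (hA i x) ((hbm i).mul (hfs i)),
      meromorphicOrderAt_mul (hbm i) (hfs i),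
      meromorphicOrderAt_comp_of_deriv_ne_zero (hsh i)
        (deriv_shift_ne_zero (h.ne_zero i) (by linarith [h.inv_norm_le i, h.le_radius]))]
    refine le_trans ?_ (add_le_add (neg_negPart_divisor_le_order (hA i) x)
      (add_le_add (h.analyticAt i x hx).meromorphicOrderAt_nonneg
        (neg_negPart_divisor_le_order hf.1 (shift (c i) x))))
    have h3 := Finset.single_le_sum (f := fun i => (divisor (A i) univ)⁻ x)
      (fun i _ => hnn _ _) (Finset.mem_univ i)
    have h4 := Finset.single_le_sum (f := fun i => (divisor f univ)⁻ (shift (c i) x))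
      (fun i _ => hnn _ _) (Finset.mem_univ i)
    rw [zero_add]
    norm_cast
    omega
  rw [meromorphicOrderAt_mul (hg x) (hf.1 x)] at horder
  have hd : (divisor f univ) x ≤ (divisor f univ)⁺ x := by
    rw [locallyFinsuppWithin.posPart_apply]
    exact le_posPart _
  have hd0 : 0 ≤ (divisor f univ)⁺ x := by
    rw [locallyFinsuppWithin.posPart_apply]
    exact posPart_nonneg _
  have hM0 : 0 ≤ M := add_nonneg (Finset.sum_nonneg fun i _ => hnn _ _)
    (Finset.sum_nonneg fun i _ => hnn _ _)
  rw [divisor_apply hf.1.meromorphicOn (mem_univ x)] at hd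
  have goal : (divisor g univ)⁻ x ≤ M + (divisor f univ)⁺ x := by
    rw [locallyFinsuppWithin.negPart_apply, divisor_apply hg.meromorphicOn (mem_univ x)]
    have hfx := order_ne_top hf x
    lift meromorphicOrderAt f x to ℤ using hfx with d
    rw [WithTop.untop₀_coe] at hd
    cases hgx : meromorphicOrderAt g x with
    | top =>
      simp only [WithTop.untop₀_top, negPart_zero]
      omega
    | coe m =>
      rw [hgx] at horder
      rw [WithTop.untop₀_coe]
      have h5 : -M ≤ m + d := by exact_mod_cast horder
      rw [negPart_def]
      exact sup_le (by omega) (by omega)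
  rw [hM] at goal
  linarith

/-- The shift is injective outside the disk of radius X and enlarges moduli by at most the factor L,
so log r - log|y| ≤ log(Lr) - log|shift y|. The maximum with 1 covers an empty `F`, for which r is
unrestricted. -/
theorem sum_shift_le_logCounting (h : ShiftRelation g A f c b X B L) (i : ι) {r : ℝ}
    (F : Finset ℂ) (hF : ∀ y ∈ F, X < ‖y‖ ∧ ‖y‖ ≤ r) :
    ∑ y ∈ F, ((divisor f univ)⁻ (shift (c i) y) : ℤ) * (log r - log ‖y‖) ≤
      logCounting f ⊤ (max 1 (L * r)) := by
  classical
  have hL := h.one_le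
  have hX := h.le_radius
  rcases F.eq_empty_or_nonempty with rfl | ⟨y₀, hy₀⟩
  · simpa using logCounting_nonneg (le_max_left _ _)
  have hr1 : 1 ≤ r := by linarith [(hF y₀ hy₀).1, (hF y₀ hy₀).2]
  have hLr : 1 ≤ L * r := by nlinarith
  rw [max_eq_right hLr]
  have hnorm : ∀ y ∈ F, ‖shift (c i) y‖ ≤ L * ‖y‖ := fun y hy =>
    (norm_shift_le (h.ne_zero i) (by linarith [(hF y hy).1])).trans
      (mul_le_mul_of_nonneg_right (h.norm_add_inv_le i) (norm_nonneg _))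
  have hinj : InjOn (shift (c i)) F := fun x hx y hy hxy => by
    have hi := h.inv_norm_le i
    have h1 := le_norm_shift_sub (h.ne_zero i) (x := x) (y := y)
      (by linarith [(hF x hx).1]) (by linarith [(hF y hy).1])
    rw [hxy, sub_self, norm_zero] at h1
    have h2 : 0 < ‖c i‖ := norm_pos_iff.2 (h.ne_zero i)
    have h3 := norm_nonneg (x - y)
    have : ‖x - y‖ = 0 := by nlinarith
    exact sub_eq_zero.1 (norm_eq_zero.1 this)
  have h1 := sum_le_logCounting (negPart_nonneg (divisor f univ)) hLr (F.image (shift (c i)))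
    fun z hz => by
      obtain ⟨y, hy, rfl⟩ := Finset.mem_image.1 hz
      refine (hnorm y hy).trans ?_
      have := (hF y hy).2
      gcongr
  rw [Finset.sum_image hinj] at h1
  rw [logCounting_top]
  refine le_trans (Finset.sum_le_sum fun y hy => ?_) h1
  have hn : (0 : ℝ) ≤ ((divisor f univ)⁻ (shift (c i) y) : ℤ) := by
    rw [locallyFinsuppWithin.negPart_apply]
    exact_mod_cast negPart_nonneg _
  refine mul_le_mul_of_nonneg_left ?_ hn
  have hy0 : 0 < ‖y‖ := by linarith [(hF y hy).1]
  have h2 : log ‖shift (c i) y‖ ≤ log L + log ‖y‖ := by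
    refine log_le_of_le_exp (norm_nonneg _) (add_nonneg (log_nonneg hL)
      (log_nonneg (by linarith [(hF y hy).1]))) ?_
    rw [exp_add, exp_log (by linarith), exp_log hy0]
    exact hnorm y hy
  rw [log_mul (by linarith) (by linarith)]
  linarith

/-- The contribution of a fixed disk to the logarithmic counting function is `O(log r)`. -/
theorem sum_disk_le {D : locallyFinsupp ℂ ℤ} (hD : 0 ≤ D) (hX : 1 ≤ X) {r : ℝ} (hr : X ≤ r)
    (F : Finset ℂ) (hF : ∀ y ∈ F, ‖y‖ ≤ X) :
    ∑ y ∈ F, D y * (log r - log ‖y‖) ≤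
      locallyFinsuppWithin.logCounting D (exp 1 * X) * (log r + 1) := by
  have hX0 : 0 < X := by linarith
  have he : 1 ≤ exp 1 := one_le_exp zero_le_one
  have hXe : X ≤ exp 1 * X := by nlinarith
  have h1 := sum_le_logCounting hD (hX.trans hXe) F fun y hy => (hF y hy).trans hXe
  rw [log_mul (exp_pos 1).ne' hX0.ne', log_exp] at h1
  have hlr : 0 ≤ log r := log_nonneg (hX.trans hr)
  refine le_trans ?_ (mul_le_mul_of_nonneg_right h1 (by linarith))
  rw [Finset.sum_mul]
  refine Finset.sum_le_sum fun y hy => ?_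
  have h0 : (0 : ℝ) ≤ D y := by exact_mod_cast hD y
  rw [mul_assoc]
  refine mul_le_mul_of_nonneg_left ?_ h0
  have h2 := log_norm_le_log hX (hF y hy)
  have h3 := log_nonneg hX
  have h4 := mul_nonneg (sub_nonneg.2 h2) hlr
  nlinarith

/-- Poles of g in the disk of radius X cost O(log r), hence O(T(r,f)); those outside are charged to
the sources found in `negPart_divisor_le`. -/
theorem exists_logCounting_le (h : ShiftRelation g A f c b X B L)
    (hf : IsNonconstantMeromorphic f) (hg : Meromorphic g) (hA : ∀ i, Meromorphic (A i)) :
    ∃ C r₀ : ℝ, 0 ≤ C ∧ ∀ r Λ : ℝ, r₀ ≤ r → L ≤ Λ →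
      logCounting g ⊤ r ≤ ∑ i, logCounting (A i) ⊤ r + C * characteristic f ⊤ (Λ * r) := by
  classical
  have hL := h.one_le
  have hX := h.le_radius
  obtain ⟨r₂, hr₂, hlow⟩ := eventually_log_le_two_mul_characteristic hf
  obtain ⟨K, hK0, hK⟩ := characteristic_inv_le hf.1
  set N := logCounting g ⊤ (exp 1 * X) with hN
  have hN0 : 0 ≤ N := logCounting_nonneg (by nlinarith [one_le_exp zero_le_one])
  -- The three summands pay for the poles in the fixed disk, for the zeros of f, and for the poles
  -- of f at shifted points.
  refine ⟨4 * N + (1 + 2 * K) + Fintype.card ι, max X r₂, by positivity,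
    fun r Λ hr hΛ => ?_⟩
  have hrX : X ≤ r := (le_max_left _ _).trans hr
  have hr2 : r₂ ≤ r := (le_max_right _ _).trans hr
  have hr1 : 1 ≤ r := by linarith
  have hr0 : 0 < r := by linarith
  have hLr : L * r ≤ Λ * r := by gcongr
  have hrL : r ≤ L * r := by nlinarith
  have hT : characteristic f ⊤ r ≤ characteristic f ⊤ (Λ * r) :=
    characteristic_monotoneOn hf.1 hr0 (by simp only [mem_Ioi]; linarith) (by linarith)
  obtain ⟨F, hF, hF'⟩ := exists_finset_support (divisor g univ)⁻ hr0
  have e0 : logCounting g ⊤ r =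
      ∑ y ∈ F, ((divisor g univ)⁻ y : ℤ) * (log r - log ‖y‖) := by
    rw [logCounting_top, logCounting_eq_sum _ hr0 F hF hF']
  set F₁ := F.filter fun y => ‖y‖ ≤ X with hF₁
  set F₂ := F.filter fun y => ¬ ‖y‖ ≤ X with hF₂
  have hF₂' : ∀ y ∈ F₂, X < ‖y‖ ∧ ‖y‖ ≤ r := fun y hy => by
    rw [hF₂, Finset.mem_filter] at hy
    exact ⟨not_le.1 hy.2, hF y hy.1⟩
  have e1 : ∑ y ∈ F₁, ((divisor g univ)⁻ y : ℤ) * (log r - log ‖y‖) ≤ N * (log r + 1) := by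
    rw [hN, logCounting_top]
    exact sum_disk_le (negPart_nonneg _) (by linarith) hrX F₁ fun y hy =>
      (Finset.mem_filter.1 hy).2
  have e2 : ∑ y ∈ F₂, ((divisor g univ)⁻ y : ℤ) * (log r - log ‖y‖) ≤
      ∑ i, logCounting (A i) ⊤ r + logCounting f 0 r +
        Fintype.card ι * logCounting f ⊤ (L * r) := by
    have s1 : ∀ i, ∑ y ∈ F₂, ((divisor (A i) univ)⁻ y : ℤ) * (log r - log ‖y‖) ≤
        logCounting (A i) ⊤ r := fun i => by
      rw [logCounting_top]
      exact sum_le_logCounting (negPart_nonneg _) hr1 F₂ fun y hy => (hF₂' y hy).2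
    have s2 : ∑ y ∈ F₂, ((divisor f univ)⁺ y : ℤ) * (log r - log ‖y‖) ≤ logCounting f 0 r := by
      rw [logCounting_zero]
      exact sum_le_logCounting (posPart_nonneg _) hr1 F₂ fun y hy => (hF₂' y hy).2
    have s3 : ∀ i, ∑ y ∈ F₂, ((divisor f univ)⁻ (shift (c i) y) : ℤ) * (log r - log ‖y‖) ≤
        logCounting f ⊤ (L * r) := fun i => by
      have := h.sum_shift_le_logCounting i F₂ hF₂'
      rwa [max_eq_right (by linarith)] at this
    calc ∑ y ∈ F₂, ((divisor g univ)⁻ y : ℤ) * (log r - log ‖y‖)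
        ≤ ∑ y ∈ F₂, ((∑ i, ((divisor (A i) univ)⁻ y : ℤ) + ((divisor f univ)⁺ y : ℤ) +
            ∑ i, ((divisor f univ)⁻ (shift (c i) y) : ℤ) : ℤ) : ℝ) * (log r - log ‖y‖) := by
          refine Finset.sum_le_sum fun y hy => mul_le_mul_of_nonneg_right ?_ ?_
          · exact_mod_cast h.negPart_divisor_le hf hg hA (hF₂' y hy).1
          · linarith [log_norm_le_log hr1 (hF₂' y hy).2]
      _ = ∑ i, ∑ y ∈ F₂, ((divisor (A i) univ)⁻ y : ℤ) * (log r - log ‖y‖) +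
            ∑ y ∈ F₂, ((divisor f univ)⁺ y : ℤ) * (log r - log ‖y‖) +
            ∑ i, ∑ y ∈ F₂, ((divisor f univ)⁻ (shift (c i) y) : ℤ) * (log r - log ‖y‖) := by
          rw [Finset.sum_comm (s := Finset.univ), Finset.sum_comm (s := Finset.univ),
            ← Finset.sum_add_distrib, ← Finset.sum_add_distrib]
          refine Finset.sum_congr rfl fun y _ => ?_
          push_cast
          rw [add_mul, add_mul, Finset.sum_mul, Finset.sum_mul]
      _ ≤ _ := by
          refine add_le_add (add_le_add (Finset.sum_le_sum fun i _ => s1 i) s2)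
            ((Finset.sum_le_sum fun i _ => s3 i).trans_eq ?_)
          simp
  have e3 : logCounting f 0 r ≤ characteristic f ⊤ (Λ * r) + K := by
    have h1 := hK r
    have h2 : 0 ≤ proximity f⁻¹ ⊤ r := proximity_nonneg r
    rw [characteristic, Pi.add_apply, logCounting_inv] at h1
    linarith
  have e4 : logCounting f ⊤ (L * r) ≤ characteristic f ⊤ (Λ * r) := by
    have h1 : logCounting f ⊤ (L * r) ≤ logCounting f ⊤ (Λ * r) :=
      logCounting_monotoneOn (by simp only [mem_Ioi]; linarith)
        (by simp only [mem_Ioi]; linarith) hLr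
    have h2 : 0 ≤ proximity f ⊤ (Λ * r) := proximity_nonneg _
    rw [characteristic, Pi.add_apply]
    linarith
  have e5 := (hlow r hr2).1
  have e6 := (hlow r hr2).2
  rw [e0, ← Finset.sum_filter_add_sum_filter_not F (fun y => ‖y‖ ≤ X)]
  have e7 : N * (log r + 1) ≤ N * (4 * characteristic f ⊤ (Λ * r)) :=
    mul_le_mul_of_nonneg_left (by linarith) hN0
  have e8 : K ≤ 2 * K * characteristic f ⊤ (Λ * r) := by nlinarith
  have e9 : Fintype.card ι * logCounting f ⊤ (L * r) ≤
      Fintype.card ι * characteristic f ⊤ (Λ * r) :=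
    mul_le_mul_of_nonneg_left e4 (Nat.cast_nonneg _)
  linarith

end ShiftRelation

end AskeyWilsonGrowth


namespace AskeyWilsonGrowth

open Real Metric Function Topology ValueDistribution MeromorphicOn

/-! ### Growth of the characteristic of the leading coefficient -/

theorem logCounting_top_eq_zero {g : ℂ → ℂ} (hg : Differentiable ℂ g) : logCounting g ⊤ = 0 := by
  have h1 : AnalyticOnNhd ℂ g univ := fun x _ => hg.analyticAt x
  have h2 : (divisor g univ)⁻ = 0 := negPart_eq_zero.2 h1.divisor_nonneg
  rw [logCounting_top, h2, map_zero]

theorem exists_shiftRelation {p : ℂ} (hp0 : p ≠ 0) (hp1 : ‖p‖ < 1) {n : ℕ} {a : ℕ → ℂ → ℂ}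
    {f : ℂ → ℂ} (hsol : SolvesAskeyWilson p n a f) :
    ∃ (ι : Type) (_ : Fintype ι) (k : ι → ℕ) (c : ι → ℂ) (b : ι → ℂ → ℂ) (X B L : ℝ),
      (∀ i, 1 ≤ k i ∧ k i ≤ n) ∧ ShiftRelation (a 0) (fun i => a (k i)) f c b X B L := by
  obtain ⟨ι, inst, k, c, b, X, B, -, hk, hc, hb, hD⟩ := exists_askeyWilson_sum_shift hp0 hp1 n
  have hnn : ∀ i, 0 ≤ 3 * ‖c i‖ + ‖c i‖⁻¹ := fun i => by positivity
  set L := 1 + ∑ i, (3 * ‖c i‖ + ‖c i‖⁻¹) with hL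
  refine ⟨ι, inst, k, c, b, max X (1 + 2 * L), B, L, hk, ?_, hc, fun i => ?_, le_max_right _ _,
    fun i x hx => (hb i x ((le_max_left _ _).trans_lt hx)).1,
    fun i x hx => (hb i x ((le_max_left _ _).trans_lt hx)).2, ?_⟩
  · have := Finset.sum_nonneg fun i (_ : i ∈ Finset.univ) => hnn i
    linarith
  · have := Finset.single_le_sum (fun i _ => hnn i) (Finset.mem_univ i)
    linarith
  · filter_upwards [hsol] with x hx hxX
    rw [hD a f x ((le_max_left _ _).trans_lt hxX)] at hx
    exact eq_neg_of_add_eq_zero_left hx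

namespace ShiftRelation

variable {ι : Type} [Fintype ι] {g : ℂ → ℂ} {A : ι → ℂ → ℂ} {f : ℂ → ℂ} {c : ι → ℂ}
  {b : ι → ℂ → ℂ} {X B L : ℝ}

/-- The pole count already costs T(Λr,f), so S = Λr is taken in the proximity estimate; there
log(S/r) = log Λ ≥ 1. -/
theorem exists_characteristic_le (h : ShiftRelation g A f c b X B L)
    (hf : IsNonconstantMeromorphic f) (hg : Meromorphic g) (hA : ∀ i, Meromorphic (A i)) :
    ∃ C r₀ Λ : ℝ, 0 ≤ C ∧ 4 ≤ Λ ∧ ∀ r, r₀ ≤ r →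
      characteristic g ⊤ r ≤
        ∑ i, characteristic (A i) ⊤ r + C * characteristic f ⊤ (Λ * r) := by
  obtain ⟨C₁, r₁, Λ₁, hC₁, hΛ₁, h1⟩ := h.exists_proximity_le hf hg hA
  obtain ⟨C₂, r₂, hC₂, h2⟩ := h.exists_logCounting_le hf hg hA
  set Λ := max Λ₁ L
  have hΛ : 4 ≤ Λ := hΛ₁.trans (le_max_left _ _)
  refine ⟨C₁ + C₂, max 1 (max r₁ r₂), Λ, by positivity, hΛ, fun r hr => ?_⟩
  have hr0 : 1 ≤ r := (le_max_left _ _).trans hr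
  have hr1 : r₁ ≤ r := ((le_max_left _ _).trans (le_max_right _ _)).trans hr
  have hr2 : r₂ ≤ r := ((le_max_right _ _).trans (le_max_right _ _)).trans hr
  have e1 := h1 r (Λ * r) hr1 (mul_le_mul_of_nonneg_right (le_max_left _ _) (by linarith))
  have e2 := h2 r Λ hr2 (le_max_right _ _)
  have hT : 0 ≤ characteristic f ⊤ (Λ * r) := characteristic_nonneg (by nlinarith)
  have hlog : 1 ≤ log (Λ * r / r) := by
    rw [mul_div_cancel_right₀ _ (by linarith : r ≠ 0), le_log_iff_exp_le (by linarith)]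
    linarith [exp_one_lt_d9]
  have e3 : C₁ * (characteristic f ⊤ (Λ * r) / log (Λ * r / r)) ≤
      C₁ * characteristic f ⊤ (Λ * r) :=
    mul_le_mul_of_nonneg_left (div_le_self hT hlog) hC₁
  simp only [characteristic, Pi.add_apply, Finset.sum_add_distrib] at *
  linarith

/-- An entire g has no poles to count, so S stays free and the denominator log(S/r) survives. -/
theorem exists_characteristic_le_of_entire (h : ShiftRelation g A f c b X B L)
    (hf : IsNonconstantMeromorphic f) (hg : Differentiable ℂ g) (hA : ∀ i, Meromorphic (A i)) :
    ∃ C r₀ Λ : ℝ, 0 ≤ C ∧ 4 ≤ Λ ∧ ∀ r S : ℝ, r₀ ≤ r → Λ * r ≤ S →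
      characteristic g ⊤ r ≤
        ∑ i, characteristic (A i) ⊤ r + C * (characteristic f ⊤ S / log (S / r)) := by
  have hgm : Meromorphic g := fun x => (hg.analyticAt x).meromorphicAt
  obtain ⟨C, r₁, Λ, hC, hΛ, h1⟩ := h.exists_proximity_le hf hgm hA
  refine ⟨C, max 1 r₁, Λ, hC, hΛ, fun r S hr hS => ?_⟩
  have e1 := h1 r S ((le_max_right _ _).trans hr) hS
  have e2 : ∀ i, proximity (A i) ⊤ r ≤ characteristic (A i) ⊤ r := fun i =>
    le_add_of_nonneg_right (logCounting_nonneg ((le_max_left _ _).trans hr))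
  have e3 : characteristic g ⊤ r = proximity g ⊤ r := by
    rw [characteristic, logCounting_top_eq_zero hg, add_zero]
  rw [e3]
  exact e1.trans (add_le_add (Finset.sum_le_sum fun i _ => e2 i) le_rfl)

end ShiftRelation

/-! ### The scale -/

theorem growth_tendsto_atTop {R₀ : ℝ} {φ : ℝ → ℝ} (hφ : IsGrowthFunction R₀ φ) :
    Tendsto φ atTop atTop :=
  tendsto_atTop_mono' _ hφ.log_le tendsto_log_atTop

/-- Iterated doubling gives φ(2^m r) ≤ 2^m φ(r), and K < 2^m for some m. Hence a dilation of the
radius does not affect φ-orders. -/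
theorem exists_growth_mul_le {R₀ : ℝ} {φ : ℝ → ℝ} (hφ : IsGrowthFunction R₀ φ)
    (hsub : EventuallySubadditive φ) {K : ℝ} (hK : 0 < K) :
    ∃ M : ℝ, 0 < M ∧ ∀ᶠ r in atTop, φ (K * r) ≤ M * φ r := by
  obtain ⟨R₁, hR₁⟩ := hsub
  obtain ⟨m, hm⟩ := pow_unbounded_of_one_lt K (one_lt_two (α := ℝ))
  have hpow : ∀ j : ℕ, ∀ r, 0 ≤ r → R₁ ≤ r → φ (2 ^ j * r) ≤ 2 ^ j * φ r := by
    intro j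
    induction j with
    | zero => simp
    | succ j ih =>
      intro r hr0 hr
      have h1 : r ≤ 2 ^ j * r := le_mul_of_one_le_left hr0 (one_le_pow₀ one_le_two)
      have h2 := hR₁ (2 ^ j * r) (2 ^ j * r) (hr.trans h1) (hr.trans h1)
      have h3 := ih r hr0 hr
      rw [show (2 : ℝ) ^ (j + 1) * r = 2 ^ j * r + 2 ^ j * r by ring, pow_succ]
      linarith
  refine ⟨2 ^ m, by positivity, ?_⟩
  filter_upwards [eventually_gt_atTop 0, eventually_ge_atTop R₁,
    (tendsto_id.const_mul_atTop hK).eventually_gt_atTop R₀] with r h0 h1 h2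
  refine le_trans (hφ.mono h2 ?_ ?_) (hpow m r h0.le h1)
  · exact lt_of_lt_of_le h2 (mul_le_mul_of_nonneg_right hm.le h0.le)
  · exact mul_le_mul_of_nonneg_right hm.le h0.le

/-! ### From bounds on characteristics to φ-orders -/

theorem phiOrder_lt_imp {φ : ℝ → ℝ} (hφ : Tendsto φ atTop atTop) {g : ℂ → ℂ} {β : ℝ}
    (h : phiOrder φ g < β) : ∀ᶠ r in atTop, characteristic g ⊤ r ≤ φ r ^ β := by
  filter_upwards [eventually_lt_of_limsup_lt h, hφ.eventually_gt_atTop 1] with r h1 h2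
  rcases le_or_gt (characteristic g ⊤ r) 0 with h0 | h0
  · exact h0.trans (rpow_nonneg (by linarith) _)
  · rw [ENNReal.log_ofReal_of_pos h0, ← EReal.coe_div, EReal.coe_lt_coe_iff,
      div_lt_iff₀ (log_pos h2)] at h1
    rw [← log_le_log_iff h0 (rpow_pos_of_pos (by linarith) _), log_rpow (by linarith)]
    exact h1.le

theorem lt_phiOrder_imp {φ : ℝ → ℝ} (hφ : Tendsto φ atTop atTop) {g : ℂ → ℂ} {β : ℝ}
    (h : β < phiOrder φ g) : ∃ᶠ r in atTop, φ r ^ β < characteristic g ⊤ r := by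
  refine ((frequently_lt_of_lt_limsup (by isBoundedDefault) h).and_eventually
    (hφ.eventually_gt_atTop 1)).mono fun r hr => ?_
  obtain ⟨h1, h2⟩ := hr
  have hl := log_pos h2
  rcases le_or_gt (characteristic g ⊤ r) 0 with h0 | h0
  · rw [ENNReal.ofReal_of_nonpos h0, ENNReal.log_zero,
      EReal.bot_div_of_pos_ne_top (by exact_mod_cast hl) (EReal.coe_ne_top _)] at h1
    exact absurd h1 not_lt_bot
  · rw [ENNReal.log_ofReal_of_pos h0, ← EReal.coe_div, EReal.coe_lt_coe_iff,
      lt_div_iff₀ hl] at h1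
    rw [← log_lt_log_iff (rpow_pos_of_pos (by linarith) _) h0, log_rpow (by linarith)]
    exact h1

theorem phiOrder_le_of_eventually_le {φ : ℝ → ℝ} (hφ : Tendsto φ atTop atTop) {g : ℂ → ℂ}
    {C₁ C₂ β₁ β₂ β : ℝ}
    (h : ∀ᶠ r in atTop, characteristic g ⊤ r ≤ C₁ * φ r ^ β₁ + C₂ * φ r ^ β₂)
    (h₁ : β₁ < β) (h₂ : β₂ < β) : phiOrder φ g ≤ β := by
  by_contra! hlt
  have hsmall : ∀ C β' : ℝ, β' < β → ∀ᶠ r in atTop, C * φ r ^ β' ≤ φ r ^ β / 2 := by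
    intro C β' hβ'
    have ht := (tendsto_rpow_atTop (sub_pos.2 hβ')).comp hφ
    filter_upwards [ht.eventually_ge_atTop (2 * C), hφ.eventually_gt_atTop 0] with r hr h0
    have e : φ r ^ β = φ r ^ (β - β') * φ r ^ β' := by
      rw [← rpow_add h0]
      ring_nf
    have := rpow_pos_of_pos h0 β'
    simp only [comp_apply] at hr
    rw [e]
    nlinarith
  obtain ⟨r, hr, h3, h4, h5⟩ := ((lt_phiOrder_imp hφ hlt).and_eventually
    (h.and ((hsmall C₁ β₁ h₁).and (hsmall C₂ β₂ h₂)))).exists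
  linarith

/-- A negative order would force T(r,f) < 1 for large r, against T(r,f) ≥ (log r)/2. -/
theorem phiOrder_nonneg {φ : ℝ → ℝ} (hφ : Tendsto φ atTop atTop) {f : ℂ → ℂ}
    (hf : IsNonconstantMeromorphic f) : 0 ≤ phiOrder φ f := by
  by_contra! h
  obtain ⟨β, hβ, hβ0⟩ := EReal.lt_iff_exists_real_btwn.1 h
  obtain ⟨r₀, hr₀, hlow⟩ := eventually_log_le_two_mul_characteristic hf
  obtain ⟨r, h1, h2, h3, h4⟩ := ((phiOrder_lt_imp hφ hβ).and
    ((hφ.eventually_gt_atTop 1).and ((eventually_ge_atTop r₀).and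
      (tendsto_log_atTop.eventually_ge_atTop 2)))).exists
  have h5 := (hlow r h3).1
  have h6 := rpow_lt_one_of_one_lt_of_neg h2 (by exact_mod_cast hβ0)
  linarith

theorem exists_real_btwn_of_forall_lt {ι : Type} [Fintype ι] {u : ι → EReal} {y : EReal}
    (hy : y ≠ ⊥) (h : ∀ i, u i < y) : ∃ β : ℝ, (∀ i, u i < β) ∧ (β : EReal) < y := by
  have h1 : Finset.univ.sup u < y :=
    (Finset.sup_lt_iff (bot_lt_iff_ne_bot.2 hy)).2 fun i _ => h i
  obtain ⟨β, h2, h3⟩ := EReal.lt_iff_exists_real_btwn.1 h1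
  exact ⟨β, fun i => (Finset.le_sup (Finset.mem_univ i)).trans_lt h2, h3⟩

theorem eventually_sum_characteristic_le {φ : ℝ → ℝ} (hφ : Tendsto φ atTop atTop) {ι : Type}
    [Fintype ι] {A : ι → ℂ → ℂ} {β : ℝ} (h : ∀ i, phiOrder φ (A i) < β) :
    ∀ᶠ r in atTop, ∑ i, characteristic (A i) ⊤ r ≤ Fintype.card ι * φ r ^ β := by
  filter_upwards [eventually_all.2 fun i => phiOrder_lt_imp hφ (h i)] with r hr
  refine (Finset.sum_le_sum fun i _ => hr i).trans_eq ?_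
  simp

namespace ShiftRelation

variable {ι : Type} [Fintype ι] {g : ℂ → ℂ} {A : ι → ℂ → ℂ} {f : ℂ → ℂ} {c : ι → ℂ}
  {b : ι → ℂ → ℂ} {X B L : ℝ} {R₀ : ℝ} {φ s : ℝ → ℝ}

theorem phiOrder_le (h : ShiftRelation g A f c b X B L) (hφ : IsGrowthFunction R₀ φ)
    (hsub : EventuallySubadditive φ) (hf : IsNonconstantMeromorphic f) (hg : Meromorphic g)
    (hA : ∀ i, Meromorphic (A i)) (hdom : ∀ i, phiOrder φ (A i) < phiOrder φ g) :
    phiOrder φ g ≤ phiOrder φ f := by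
  have hφt := (growth_tendsto_atTop hφ)
  by_contra! hlt
  have hbot : phiOrder φ g ≠ ⊥ := (bot_le.trans_lt hlt).ne'
  -- `Option ι` adjoins f to the coefficients, so that one exponent β separates all their orders
  -- from that of g.
  obtain ⟨β, hβ, hβg⟩ := exists_real_btwn_of_forall_lt (u := fun o : Option ι =>
    o.elim (phiOrder φ f) fun i => phiOrder φ (A i)) hbot (by rintro (_ | i); exacts [hlt, hdom i])
  have hβf : phiOrder φ f < β := hβ none
  have hβA : ∀ i, phiOrder φ (A i) < β := fun i => hβ (some i)
  have hβ0 : 0 < β := by exact_mod_cast (phiOrder_nonneg hφt hf).trans_lt hβf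
  obtain ⟨β', hββ', hβ'g⟩ := EReal.lt_iff_exists_real_btwn.1 hβg
  have hlt' : β < β' := by exact_mod_cast hββ'
  obtain ⟨C, r₀, Λ, hC, hΛ, hT⟩ := h.exists_characteristic_le hf hg hA
  obtain ⟨M, hM, hMφ⟩ := exists_growth_mul_le hφ hsub (by linarith : 0 < Λ)
  have hΛt : Tendsto (fun r : ℝ => Λ * r) atTop atTop :=
    tendsto_id.const_mul_atTop (by linarith)
  refine absurd (phiOrder_le_of_eventually_le hφt (C₁ := Fintype.card ι) (C₂ := C * M ^ β)
    (β₁ := β) (β₂ := β) (β := β') ?_ hlt' hlt') (not_le.2 hβ'g)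
  filter_upwards [eventually_ge_atTop r₀, eventually_sum_characteristic_le hφt hβA, hMφ,
    hΛt.eventually (phiOrder_lt_imp hφt hβf), hφt.eventually_gt_atTop 0,
    hΛt.eventually (hφt.eventually_gt_atTop 0)] with r h1 h2 h3 h4 h5 h6
  refine (hT r h1).trans (add_le_add h2 ?_)
  rw [mul_assoc, ← mul_rpow hM.le h5.le]
  exact mul_le_mul_of_nonneg_left (h4.trans (rpow_le_rpow h6.le h3 hβ0.le)) hC

theorem mul_add_le_of_entire (h : ShiftRelation g A f c b X B L) (hφ : IsGrowthFunction R₀ φ)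
    (hsub : EventuallySubadditive φ) (hs : IsScaleFunction R₀ s)
    (hf : IsNonconstantMeromorphic f) (hg : Differentiable ℂ g) (hA : ∀ i, Meromorphic (A i))
    (hdom : ∀ i, phiOrder φ (A i) < phiOrder φ g) {ρ ρ₀ α γ : ℝ} (hρ : phiOrder φ f = ρ)
    (hρ₀ : phiOrder φ g = ρ₀) (hα : alphaParam φ s = α) (hγ : gammaParam φ s = γ) (hα0 : 0 ≤ α) :
    α * (ρ₀ + γ) ≤ ρ := by
  have hφt := (growth_tendsto_atTop hφ)
  have hρ0 : 0 ≤ ρ := by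
    have := phiOrder_nonneg hφt hf
    rw [hρ] at this
    exact_mod_cast this
  by_contra! hlt
  have hαpos : 0 < α := hα0.lt_of_ne fun h0 => by
    rw [← h0] at hlt
    linarith
  -- η measures the supposed failure. With t < ρ/α + η/2 and γ - η/4 in place of γ, the exponent t -
  -- (γ - η/4) of the last error term is below ρ₀ - η/4, a contradiction. Choosing β between ρ and
  -- tα makes φ(s(r))^β ≤ φ(r)^t.
  set η := ρ₀ + γ - ρ / α with hη
  have hη0 : 0 < η := by
    rw [hη, sub_pos, div_lt_iff₀ hαpos]
    linarith
  obtain ⟨t, ht1, ht2⟩ := exists_between (show ρ / α < ρ / α + η / 2 by linarith)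
  have ht0 : 0 < t := (div_nonneg hρ0 hα0).trans_lt ht1
  rw [div_lt_iff₀ hαpos] at ht1
  obtain ⟨β, hβ1, hβ2⟩ := exists_between ht1
  have hβ0 : 0 < β := hρ0.trans_lt hβ1
  have hα' : β / t < α := by rwa [div_lt_iff₀ ht0, mul_comm]
  obtain ⟨σ, hσA, hσg⟩ := exists_real_btwn_of_forall_lt (by rw [hρ₀]; exact EReal.coe_ne_bot _) hdom
  rw [hρ₀] at hσg
  have hσ : σ < ρ₀ := by exact_mod_cast hσg
  have hτ : t - (γ - η / 4) < ρ₀ := by linarith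
  obtain ⟨ρ', hρ'1, hρ'2⟩ := exists_between (max_lt hσ hτ)
  obtain ⟨C, r₀, Λ, hC, hΛ, hT⟩ := h.exists_characteristic_le_of_entire hf hg hA
  obtain ⟨M, hM, hMφ⟩ := exists_growth_mul_le hφ hsub (by linarith : 0 < Λ)
  have hst : Tendsto s atTop atTop :=
    tendsto_atTop_mono' _ (hs.lt_self.mono fun _ h => h.le) tendsto_id
  have hΛt : Tendsto (fun r => Λ * s r) atTop atTop := hst.const_mul_atTop (by linarith)
  have hαev : ∀ᶠ r in atTop, β / t < log (φ r) / log (φ (s r)) := by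
    have h1 : ((β / t : ℝ) : EReal) < alphaParam φ s := by
      rw [hα]
      exact_mod_cast hα'
    filter_upwards [eventually_lt_of_lt_liminf h1] with r hr
    exact_mod_cast hr
  have hγev : ∀ᶠ r in atTop, γ - η / 4 < log (log (s r / r)) / log (φ r) := by
    have h1 : ((γ - η / 4 : ℝ) : EReal) < gammaParam φ s := by
      rw [hγ]
      exact_mod_cast (by linarith : γ - η / 4 < γ)
    filter_upwards [eventually_lt_of_lt_liminf h1] with r hr
    exact_mod_cast hr
  have hρβ : phiOrder φ f < β := by
    rw [hρ]
    exact_mod_cast hβ1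
  refine absurd (phiOrder_le_of_eventually_le hφt (C₁ := Fintype.card ι) (C₂ := C * M ^ β)
    (β₁ := σ) (β₂ := t - (γ - η / 4)) (β := ρ') ?_ ((le_max_left _ _).trans_lt hρ'1)
    ((le_max_right _ _).trans_lt hρ'1)) (not_le.2 (by rw [hρ₀]; exact_mod_cast hρ'2))
  filter_upwards [eventually_ge_atTop r₀, eventually_sum_characteristic_le hφt hσA,
    hst.eventually hMφ, hΛt.eventually (phiOrder_lt_imp hφt hρβ), hφt.eventually_gt_atTop 1,
    hst.eventually (hφt.eventually_gt_atTop 1), hΛt.eventually (hφt.eventually_gt_atTop 0),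
    hαev, hγev, hs.lt_self, eventually_gt_atTop 0, hΛt.eventually_ge_atTop 1]
    with r h1 h2 h3 h4 h5 h6 h7 h8 h9 h10 h11 h12
  -- S = Λs(r) is used rather than s(r), since only s(r) > r is known and the estimate needs S ≥ Λr.
  -- The factor Λ costs a constant `M` in φ and only increases log(S/r).
  have hS : Λ * r ≤ Λ * s r := mul_le_mul_of_nonneg_left h10.le (by linarith)
  refine (hT r (Λ * s r) h1 hS).trans (add_le_add h2 ?_)
  have hq : 1 < s r / r := by rwa [one_lt_div h11]
  have hlog0 : 0 < log (s r / r) := log_pos hq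
  have e1 : φ r ^ (γ - η / 4) ≤ log (s r / r) := by
    rw [lt_div_iff₀ (log_pos h5)] at h9
    rw [← log_le_log_iff (rpow_pos_of_pos (by linarith) _) hlog0, log_rpow (by linarith)]
    exact h9.le
  have e2 : log (s r / r) ≤ log (Λ * s r / r) := by
    refine log_le_log (by linarith) ?_
    rw [mul_div_assoc]
    exact le_mul_of_one_le_left (by linarith) (by linarith)
  have e3 : φ (s r) ^ β ≤ φ r ^ t := by
    rw [lt_div_iff₀ (log_pos h6), div_mul_eq_mul_div, div_lt_iff₀ ht0] at h8
    rw [← log_le_log_iff (rpow_pos_of_pos (by linarith) _) (rpow_pos_of_pos (by linarith) _),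
      log_rpow (by linarith), log_rpow (by linarith)]
    linarith
  have e4 : characteristic f ⊤ (Λ * s r) ≤ M ^ β * φ r ^ t := by
    refine h4.trans ((rpow_le_rpow h7.le h3 hβ0.le).trans ?_)
    rw [mul_rpow hM.le (by linarith)]
    exact mul_le_mul_of_nonneg_left e3 (rpow_nonneg hM.le _)
  have hpos : 0 < φ r ^ (γ - η / 4) := rpow_pos_of_pos (by linarith) _
  rw [mul_assoc, rpow_sub (by linarith)]
  refine mul_le_mul_of_nonneg_left ?_ hC
  rw [← mul_div_assoc]
  exact div_le_div₀ (mul_nonneg (rpow_nonneg hM.le _) (rpow_nonneg (by linarith) _)) e4 hpos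
    (e1.trans e2)

end ShiftRelation

/-! ### The parameters -/

section Parameters

variable {R₀ : ℝ} {φ s : ℝ → ℝ}

theorem exists_alphaParam_eq (hφ : IsGrowthFunction R₀ φ) (hs : IsScaleFunction R₀ s) :
    ∃ α : ℝ, alphaParam φ s = α ∧ 0 ≤ α ∧ α ≤ 1 := by
  have hev : ∀ᶠ r in atTop, 0 ≤ log (φ r) / log (φ (s r)) ∧ log (φ r) / log (φ (s r)) ≤ 1 := by
    filter_upwards [(growth_tendsto_atTop hφ).eventually_gt_atTop 1, hs.lt_self, eventually_gt_atTop R₀]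
      with r h1 h2 h3
    have h4 : φ r ≤ φ (s r) := hφ.mono h3 (lt_trans h3 h2) h2.le
    have h5 := log_pos h1
    have h6 : log (φ r) ≤ log (φ (s r)) := log_le_log (by linarith) h4
    exact ⟨div_nonneg h5.le (by linarith), div_le_one_of_le₀ h6 (by linarith)⟩
  have h0 : (0 : EReal) ≤ alphaParam φ s :=
    le_liminf_of_le (by isBoundedDefault) (hev.mono fun r hr => by exact_mod_cast hr.1)
  have h1 : alphaParam φ s ≤ 1 := by
    refine (liminf_le_liminf (v := fun _ => (1 : EReal)) (hev.mono fun r hr => ?_)).trans_eq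
      (liminf_const _)
    exact_mod_cast hr.2
  lift alphaParam φ s to ℝ using
    ⟨(h1.trans_lt (EReal.coe_lt_top 1)).ne, ((EReal.bot_lt_coe 0).trans_le h0).ne'⟩ with α
  exact ⟨α, rfl, by exact_mod_cast h0, by exact_mod_cast h1⟩

/-- In fact 0 ≤ γ ≤ 1: s(r)/r eventually exceeds some d > 1 while log φ(r) tends to infinity, and
log(s(r)/r) ≤ log r ≤ φ(r) because s(r) ≤ r². -/
theorem exists_gammaParam_eq (hφ : IsGrowthFunction R₀ φ) (hs : IsScaleFunction R₀ s) :
    ∃ γ : ℝ, gammaParam φ s = γ := by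
  obtain ⟨d, hd1, hd2⟩ := EReal.lt_iff_exists_real_btwn.1 hs.one_lt_liminf
  have hd : 1 < d := by exact_mod_cast hd1
  have hev : ∀ᶠ r in atTop, log (log d) / log (φ r) ≤ log (log (s r / r)) / log (φ r) ∧
      log (log (s r / r)) / log (φ r) ≤ 1 := by
    filter_upwards [(growth_tendsto_atTop hφ).eventually_gt_atTop 1, eventually_lt_of_lt_liminf hd2,
      hs.le_sq, hφ.log_le, eventually_gt_atTop 0] with r h1 h2 h3 h4 h5
    have h6 : d < s r / r := by exact_mod_cast h2
    have h7 := log_pos h1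
    have h8 : log d ≤ log (s r / r) := log_le_log (by linarith) h6.le
    have h9 : log (s r / r) ≤ log r := by
      refine log_le_log (by linarith) ?_
      rw [div_le_iff₀ h5]
      linarith
    have h10 := log_pos hd
    refine ⟨div_le_div_of_nonneg_right (log_le_log h10 h8) h7.le, div_le_one_of_le₀ ?_ h7.le⟩
    exact log_le_log (by linarith) (by linarith)
  have h0 : (0 : EReal) ≤ gammaParam φ s := by
    have ht : Tendsto (fun r => ((log (log d) / log (φ r) : ℝ) : EReal)) atTop (𝓝 ((0 : ℝ) : EReal)) :=
      (continuous_coe_real_ereal.tendsto 0).comp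
        ((tendsto_log_atTop.comp (growth_tendsto_atTop hφ)).const_div_atTop _)
    rw [← EReal.coe_zero, ← ht.liminf_eq]
    exact liminf_le_liminf (hev.mono fun r hr => by exact_mod_cast hr.1)
  have h1 : gammaParam φ s ≤ 1 := by
    refine (liminf_le_liminf (v := fun _ => (1 : EReal)) (hev.mono fun r hr => ?_)).trans_eq
      (liminf_const _)
    exact_mod_cast hr.2
  lift gammaParam φ s to ℝ using
    ⟨(h1.trans_lt (EReal.coe_lt_top 1)).ne, ((EReal.bot_lt_coe 0).trans_le h0).ne'⟩ with γ
  exact ⟨γ, rfl⟩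

end Parameters

end AskeyWilsonGrowth

/-! ### Conclusion -/

open AskeyWilsonGrowth in
theorem theorem2p1
    (q p : ℂ) (hq0 : 0 < ‖q‖) (hq1 : ‖q‖ < 1) (hp : p ^ 2 = q)
    (R₀ : ℝ) (φ s : ℝ → ℝ)
    (hφ : IsGrowthFunction R₀ φ) (hsub : EventuallySubadditive φ)
    (hs : IsScaleFunction R₀ s)
    (n : ℕ) (hn : 1 ≤ n) (a : ℕ → ℂ → ℂ)
    (ha : ∀ j ≤ n, Meromorphic (a j))
    (ha0n : ¬ (a 0 * a n =ᶠ[codiscrete ℂ] 0))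
    (hfin : ∀ j ≤ n, phiOrder φ (a j) < ⊤)
    (hdom : ∀ j, 1 ≤ j → j ≤ n → phiOrder φ (a j) < phiOrder φ (a 0))
    (f : ℂ → ℂ) (hf : IsNonconstantMeromorphic f) (hsol : SolvesAskeyWilson p n a f) :
    -- part (a)
    (limsup (fun r : ℝ => ((s r / r : ℝ) : EReal)) atTop = ⊤ →
      ConvexOn ℝ (Ioi R₀) s → DifferentiableOn ℝ s (Ioi R₀) →
        alphaParam φ s ^ n * phiOrder φ (a 0) ≤ phiOrder φ f ∧
        ((∀ j ≤ n, Differentiable ℂ (a j)) →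
          alphaParam φ s ^ n * phiOrder φ (a 0) + alphaParam φ s ^ n * gammaParam φ s
            ≤ phiOrder φ f)) ∧
    -- part (b)
    (limsup (fun r : ℝ => ((s r / r : ℝ) : EReal)) atTop < ⊤ →
        alphaParam φ s ^ (n - 1) * phiOrder φ (a 0) ≤ phiOrder φ f) := by
  have hp0 : p ≠ 0 := fun h => by
    rw [← hp, h] at hq0
    simp at hq0
  have hp1 : ‖p‖ < 1 := by
    rw [← hp, norm_pow] at hq1
    exact (sq_lt_one_iff₀ (norm_nonneg p)).1 hq1
  obtain ⟨ι, _, k, c, b, X, B, L, hk, hrel⟩ := exists_shiftRelation hp0 hp1 hsol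
  have hA : ∀ i, Meromorphic (a (k i)) := fun i => ha _ (hk i).2
  have hdomA : ∀ i, phiOrder φ (a (k i)) < phiOrder φ (a 0) := fun i => hdom _ (hk i).1 (hk i).2
  have hle := hrel.phiOrder_le hφ hsub hf (ha 0 (Nat.zero_le n)) hA hdomA
  have hf0 := phiOrder_nonneg (growth_tendsto_atTop hφ) hf
  obtain ⟨α, hα, hα0, hα1⟩ := exists_alphaParam_eq hφ hs
  obtain ⟨γ, hγ⟩ := exists_gammaParam_eq hφ hs
  -- The order is not -∞ because it strictly exceeds that of `a 1`, which is present since n ≥ 1.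
  obtain ⟨ρ₀, hρ₀⟩ : ∃ ρ₀ : ℝ, phiOrder φ (a 0) = ρ₀ :=
    ⟨_, (EReal.coe_toReal (hfin 0 (Nat.zero_le n)).ne (bot_le.trans_lt (hdom 1 le_rfl hn)).ne').symm⟩
  -- Any power of α ∈ [0,1] only weakens ρ₀ ≤ ρ(f) when ρ₀ ≥ 0; when ρ₀ < 0 the left side is at most
  -- 0 ≤ ρ(f).
  have hpow : ∀ m : ℕ, alphaParam φ s ^ m * phiOrder φ (a 0) ≤ phiOrder φ f := by
    intro m
    rw [hα, hρ₀, ← EReal.coe_pow, ← EReal.coe_mul]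
    rcases le_or_gt 0 ρ₀ with h | h
    · refine le_trans ?_ (hρ₀ ▸ hle)
      exact_mod_cast mul_le_of_le_one_left h (pow_le_one₀ hα0 hα1)
    · refine le_trans ?_ hf0
      exact_mod_cast mul_nonpos_of_nonneg_of_nonpos (pow_nonneg hα0 m) h.le
  refine ⟨fun _ _ _ => ⟨hpow n, fun hent => ?_⟩, fun _ => hpow (n - 1)⟩
  rcases eq_or_ne (phiOrder φ f) ⊤ with htop | htop
  · rw [htop]
    exact le_top
  obtain ⟨ρ, hρ⟩ : ∃ ρ : ℝ, phiOrder φ f = ρ :=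
    ⟨_, (EReal.coe_toReal htop (lt_of_lt_of_le EReal.bot_lt_zero hf0).ne').symm⟩
  have hρ0 : 0 ≤ ρ := by
    rw [hρ] at hf0
    exact_mod_cast hf0
  have key := hrel.mul_add_le_of_entire hφ hsub hs hf (hent 0 (Nat.zero_le n)) hA hdomA hρ hρ₀ hα hγ
    hα0
  rw [hα, hρ₀, hγ, hρ, ← EReal.coe_pow, ← EReal.coe_mul, ← EReal.coe_mul, ← EReal.coe_add,
    EReal.coe_le_coe_iff, ← mul_add]
  -- For a non-negative sum, α^n ≤ α reduces to `key`; for a negative one, ρ ≥ 0 suffices.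
  rcases le_or_gt 0 (ρ₀ + γ) with h | h
  · exact (mul_le_mul_of_nonneg_right (pow_le_of_le_one hα0 hα1 (by omega)) h).trans key
  · exact (mul_nonpos_of_nonneg_of_nonpos (pow_nonneg hα0 n) h.le).trans hρ0
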